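/- Let $\mathcal L_k\subset\mathbb R^{2n}=\{(P,Q)\}$ be a $k$-dimensional subspace which is isotropic for the symplectic form $\omega((P,Q),(P',Q'))=\sum_j (P_jQ'_j-P'_jQ_j)$, and let $d\mu$ be a (nonzero) translation-invariant Lebesgue measure on $\mathcal L_k$. For $Y=(P,Q)\in\mathbb C^{2n}$ let $\Omega(Y)=\sum_j\bigl(P_j\xi_j-Q_j\tfrac1i\tfrac{\partial}{\partial \xi_j}\bigr)$, acting on the Schwartz space $\mathcal S(\mathbb R^n)$ of complex-valued functions, and for real $Y=(P,Q)$ let $e^{i\Omega(Y)}$ be the operator $(e^{i\Omega(Y)}\psi)(\xi)=e^{i\sum_j P_j\xi_j-\frac i2\sum_j P_jQ_j}\,\psi(\xi-Q)$. Equip $\mathcal S(\mathbb R^n)$ with the positive semidefinite inner product $$\langle\psi,\varphi\rangle=\int_{\mathcal L_k}d\mu(X)\,(\psi,e^{i\Omega(X)}\varphi),\qquad (\psi,\varphi)=\int_{\mathbb R^n}\overline{\psi(\xi)}\,\varphi(\xi)\,d\xi ,$$ write $\psi\sim\varphi$ if $\langle\psi-\varphi,\psi-\varphi\rangle=0$,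 let $[\psi]$ be the class of $\psi$, and let the physical Hilbert space $\mathcal H$ be the completion of $\mathcal S(\mathbb R^n)/\!\sim$. Let $\mathcal L_k^{\perp\omega}\subset\mathbb R^{2n}$ be the skew-orthogonal complement of $\mathcal L_k$, and $(\mathcal L_k^{\mathbb C})^{\perp\omega}\subset\mathbb C^{2n}$ that of its complexification (with respect to the complex-bilinear extension of $\omega$). For $Y\in\mathcal L_k^{\perp\omega}$ the operator $e^{i\Omega(Y)}$ descends to $\mathcal S(\mathbb R^n)/\!\sim$ and extends by continuity to $\mathcal H$; for $Y\in(\mathcal L_k^{\mathbb C})^{\perp\omega}$ the operator $\Omega(Y)$ descends to $\mathcal S(\mathbb R^n)/\!\sim$. Let $\psi_A(\xi)=c\,\exp\bigl(\tfrac i2\sum_{j,l}\xi_jA_{jl}\xi_l\bigr)$ be a Gaussian function, where $c\in\mathbb C\setminus\{0\}$ and $A$ is a complex symmetric $n\times n$ matrix with positive definite imaginary part. Let $$\check r(A)=\{Y\in(\mathcal L_k^{\mathbb C})^{\perp\omega}\;:\;\|\Omega(Y)[\psi_A]\|=0\},\qquad \check r^*(A)=\{Y^*\;:\;Y\in\check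 r(A)\},$$ where $Y^*$ is the componentwise complex conjugate of $Y$. Then: 1. The set of all finite linear combinations of the vectors $e^{i\Omega(Y)}[\psi_A]$, $Y\in\mathcal L_k^{\perp\omega}$, is dense in $\mathcal H$. 2. The set of all finite linear combinations of the vectors $\Omega(Y_1^*)\cdots\Omega(Y_p^*)[\psi_A]$, $p\ge 0$, $Y_1^*,\dots,Y_p^*\in\check r^*(A)$, is dense in $\mathcal H$. -/

import Mathlib

open MeasureTheory Filter Topology
open scoped SchwartzMap LineDeriv ComplexConjugate

noncomputable section

namespace LinearConstraint

/-- The phase space `R^{2n}` of pairs `(P, Q)`, `R = ℝ` or `R = ℂ`. -/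
abbrev Phase (R : Type) (n : ℕ) : Type := (Fin n → R) × (Fin n → R)

/-- The Schwartz space `𝓢(ℝⁿ)` of complex wave functions. -/
abbrev Wave (n : ℕ) : Type := 𝓢(EuclideanSpace ℝ (Fin n), ℂ)

/-- The symplectic form `ω((P,Q),(P',Q')) = ∑ j, (P_j Q'_j - P'_j Q_j)` (bilinear also for `R = ℂ`). -/
def sympl {R : Type} [CommRing R] {n : ℕ} (X X' : Phase R n) : R :=
  ∑ j, (X.1 j * X'.2 j - X'.1 j * X.2 j)

/-- The inclusion `ℝ^{2n} ⊂ ℂ^{2n}`. -/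
def toComplex {n : ℕ} (X : Phase ℝ n) : Phase ℂ n :=
  (fun j => (X.1 j : ℂ), fun j => (X.2 j : ℂ))

/-- Multiplication by the coordinate `ξ_j`. -/
def coordOp {n : ℕ} (j : Fin n) : Wave n →L[ℂ] Wave n :=
  SchwartzMap.smulLeftCLM ℂ (fun ξ : EuclideanSpace ℝ (Fin n) => ((ξ j : ℝ) : ℂ))

/-- The partial derivative `∂/∂ξ_j`. -/
def partialOp {n : ℕ} (j : Fin n) : Wave n →L[ℂ] Wave n :=
  LineDeriv.lineDerivOpCLM ℂ (Wave n) (EuclideanSpace.single j (1 : ℝ))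

/-- `Ω(P,Q) = ∑ j, (P_j ξ_j - Q_j (1/i) ∂/∂ξ_j)`, for complex `(P,Q)`. -/
def Omega {n : ℕ} (Y : Phase ℂ n) : Wave n →L[ℂ] Wave n :=
  ∑ j, (Y.1 j • coordOp j - Y.2 j • ((1 / Complex.I) • partialOp j))

/-- The phase factor `exp (i (∑ P_j ξ_j - (1/2) ∑ P_j Q_j))`. -/
def weylPhase {n : ℕ} (X : Phase ℝ n) (ξ : EuclideanSpace ℝ (Fin n)) : ℂ :=
  Complex.exp (Complex.I * ((∑ j, X.1 j * ξ j - (1 / 2) * ∑ j, X.1 j * X.2 j : ℝ) : ℂ))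

/-- The operator `e^{iΩ(X)}`, `X = (P,Q)` real, on Schwartz functions:
`(e^{iΩ(X)} ψ)(ξ) = exp (i (∑ P_j ξ_j - (1/2) ∑ P_j Q_j)) ψ(ξ - Q)`. -/
def weyl {n : ℕ} (X : Phase ℝ n) : Wave n →L[ℂ] Wave n :=
  (SchwartzMap.smulLeftCLM ℂ (weylPhase X)).comp
    (SchwartzMap.compSubConstCLM ℂ (WithLp.toLp 2 X.2))

/-- The inner product `(ψ, φ)` of `L²(ℝⁿ)`, antilinear in the first argument. -/
def l2 {n : ℕ} (ψ φ : Wave n) : ℂ := ∫ ξ, conj (ψ ξ) * φ ξ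

section Basic

variable {n : ℕ}

theorem hasTemperateGrowth_coord (j : Fin n) :
    Function.HasTemperateGrowth (fun ξ : EuclideanSpace ℝ (Fin n) => ((ξ j : ℝ) : ℂ)) :=
  (Complex.ofRealCLM.comp (EuclideanSpace.proj (𝕜 := ℝ) j)).hasTemperateGrowth

theorem hasTemperateGrowth_cexp_I :
    Function.HasTemperateGrowth (fun t : ℝ => Complex.exp (Complex.I * (t : ℂ))) := by
  have h : ∀ m : ℕ, iteratedDeriv m (fun t : ℝ => Complex.exp (Complex.I * (t : ℂ)))
      = fun t : ℝ => Complex.I ^ m * Complex.exp (Complex.I * (t : ℂ)) := by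
    intro m
    induction m with
    | zero => simp
    | succ m ih =>
      rw [iteratedDeriv_succ, ih]
      funext t
      have : HasDerivAt (fun t : ℝ => Complex.exp (Complex.I * (t : ℂ)))
          (Complex.exp (Complex.I * (t : ℂ)) * (Complex.I * 1)) t :=
        (((Complex.ofRealCLM.hasDerivAt (x := t)).const_mul Complex.I)).cexp
      rw [(this.const_mul _).deriv]
      ring
  refine ⟨Complex.contDiff_exp.comp (contDiff_const.mul Complex.ofRealCLM.contDiff), fun m => ⟨0, 1, fun t => ?_⟩⟩
  rw [norm_iteratedFDeriv_eq_norm_iteratedDeriv, h m]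
  simp [mul_comm Complex.I, Complex.norm_exp_ofReal_mul_I]

theorem hasTemperateGrowth_weylPhase (X : Phase ℝ n) :
    Function.HasTemperateGrowth (weylPhase X) := by
  have h1 : Function.HasTemperateGrowth (fun ξ : EuclideanSpace ℝ (Fin n) =>
      ∑ j, X.1 j * ξ j - (1 / 2) * ∑ j, X.1 j * X.2 j) := by
    refine Function.HasTemperateGrowth.sub ?_ (Function.HasTemperateGrowth.const _)
    refine Function.HasTemperateGrowth.sum (fun j _ => ?_)
    exact (Function.HasTemperateGrowth.const _).mul
      (EuclideanSpace.proj (𝕜 := ℝ) j).hasTemperateGrowth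
  exact hasTemperateGrowth_cexp_I.comp h1

theorem coordOp_apply (j : Fin n) (ψ : Wave n) (ξ) : coordOp j ψ ξ = (ξ j : ℂ) * ψ ξ := by
  rw [coordOp, SchwartzMap.smulLeftCLM_apply_apply (hasTemperateGrowth_coord j)]; rfl

theorem partialOp_apply (j : Fin n) (ψ : Wave n) (ξ) :
    partialOp j ψ ξ = fderiv ℝ ψ ξ (EuclideanSpace.single j (1 : ℝ)) := by
  rw [partialOp, LineDeriv.lineDerivOpCLM_apply, SchwartzMap.lineDerivOp_apply_eq_fderiv]

theorem Omega_apply (Y : Phase ℂ n) (ψ : Wave n) (ξ) :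
    Omega Y ψ ξ = ∑ j, (Y.1 j * (ξ j * ψ ξ) + Complex.I * (Y.2 j *
      fderiv ℝ ψ ξ (EuclideanSpace.single j (1 : ℝ)))) := by
  have : Omega Y ψ ξ = ∑ j, (Y.1 j • coordOp j - Y.2 j • ((1 / Complex.I) • partialOp j)) ψ ξ := by
    simp [Omega]
  rw [this]
  refine Finset.sum_congr rfl fun j _ => ?_
  simp [coordOp_apply, partialOp_apply]
  ring

theorem weyl_apply (X : Phase ℝ n) (ψ : Wave n) (ξ) :
    weyl X ψ ξ = weylPhase X ξ * ψ (ξ - WithLp.toLp 2 X.2) := by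
  simp [weyl, SchwartzMap.smulLeftCLM_apply_apply (hasTemperateGrowth_weylPhase X)]

theorem norm_weylPhase (X : Phase ℝ n) (ξ) : ‖weylPhase X ξ‖ = 1 := by
  rw [weylPhase, mul_comm, Complex.norm_exp_ofReal_mul_I]

theorem conj_weylPhase_mul (X : Phase ℝ n) (ξ) : conj (weylPhase X ξ) * weylPhase X ξ = 1 := by
  rw [← Complex.normSq_eq_conj_mul_self, Complex.normSq_eq_norm_sq, norm_weylPhase]; simp

/-- The Weyl relations. -/
theorem weyl_weyl (X X' : Phase ℝ n) (ψ : Wave n) :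
    weyl X (weyl X' ψ) = Complex.exp (Complex.I / 2 * (sympl X X' : ℝ)) • weyl (X + X') ψ := by
  ext ξ
  simp only [weyl_apply, smul_apply, smul_eq_mul]
  have h1 : ξ - WithLp.toLp 2 X.2 - WithLp.toLp 2 X'.2
      = ξ - WithLp.toLp 2 (X + X').2 := by
    simp [sub_sub]
  rw [h1, ← mul_assoc, ← mul_assoc]
  congr 1
  simp only [weylPhase, ← Complex.exp_add]
  congr 1
  have h2 : (∑ j, X.1 j * ξ j - (1 / 2) * ∑ j, X.1 j * X.2 j)
      + (∑ j, X'.1 j * (ξ - WithLp.toLp 2 X.2 : EuclideanSpace ℝ (Fin n)) j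
        - (1 / 2) * ∑ j, X'.1 j * X'.2 j)
      = (1 / 2) * sympl X X' + (∑ j, (X + X').1 j * ξ j
        - (1 / 2) * ∑ j, (X + X').1 j * (X + X').2 j) := by
    simp only [sympl, Finset.mul_sum, ← Finset.sum_sub_distrib, ← Finset.sum_add_distrib]
    refine Finset.sum_congr rfl fun j _ => ?_
    simp
    ring
  rw [← mul_add, ← Complex.ofReal_add, h2]
  push_cast
  ring

theorem weyl_zero (ψ : Wave n) : weyl (0 : Phase ℝ n) ψ = ψ := by
  ext ξ
  simp [weyl_apply, weylPhase]

theorem sympl_self (X : Phase ℝ n) : sympl X X = 0 := by simp [sympl]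

theorem sympl_neg_right (X X' : Phase ℝ n) : sympl X (-X') = - sympl X X' := by
  simp only [sympl, ← Finset.sum_neg_distrib]
  exact Finset.sum_congr rfl fun j _ => by simp; ring

theorem sympl_comm (X X' : Phase ℝ n) : sympl X X' = - sympl X' X := by
  simp only [sympl, ← Finset.sum_neg_distrib]
  exact Finset.sum_congr rfl fun j _ => by ring

theorem sympl_toComplex (X X' : Phase ℝ n) :
    sympl (toComplex X) (toComplex X') = (sympl X X' : ℝ) := by
  simp [sympl, toComplex]

theorem l2_integrable (ψ φ : Wave n) : Integrable (fun ξ => conj (ψ ξ) * φ ξ) := by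
  refine (φ.integrable (μ := volume)).bdd_mul (c := SchwartzMap.seminorm ℝ 0 0 ψ)
    (Complex.continuous_conj.comp ψ.continuous).aestronglyMeasurable
    (Eventually.of_forall fun ξ => ?_)
  simpa using SchwartzMap.norm_le_seminorm ℝ ψ ξ

theorem l2_add_left (ψ ψ' φ : Wave n) : l2 (ψ + ψ') φ = l2 ψ φ + l2 ψ' φ := by
  rw [l2, l2, l2, ← integral_add (l2_integrable _ _) (l2_integrable _ _)]
  congr 1; ext ξ; simp; ring

theorem l2_smul_left (c : ℂ) (ψ φ : Wave n) : l2 (c • ψ) φ = conj c * l2 ψ φ := by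
  rw [l2, l2, ← integral_const_mul]
  congr 1; ext ξ; simp; ring

theorem l2_conj (ψ φ : Wave n) : conj (l2 ψ φ) = l2 φ ψ := by
  rw [l2, l2, ← integral_conj]
  congr 1; ext ξ; simp; ring

theorem l2_add_right (ψ φ φ' : Wave n) : l2 ψ (φ + φ') = l2 ψ φ + l2 ψ φ' := by
  rw [← l2_conj, l2_add_left, map_add, l2_conj, l2_conj]

theorem l2_smul_right (c : ℂ) (ψ φ : Wave n) : l2 ψ (c • φ) = c * l2 ψ φ := by
  rw [← l2_conj, l2_smul_left, map_mul, l2_conj, Complex.conj_conj]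

theorem l2_sum_left {ι : Type} (s : Finset ι) (f : ι → Wave n) (φ : Wave n) :
    l2 (∑ i ∈ s, f i) φ = ∑ i ∈ s, l2 (f i) φ := by
  classical
  induction s using Finset.induction_on with
  | empty => simp [l2]
  | insert a s ha ih => rw [Finset.sum_insert ha, Finset.sum_insert ha, l2_add_left, ih]

theorem l2_sum_right {ι : Type} (s : Finset ι) (f : ι → Wave n) (φ : Wave n) :
    l2 φ (∑ i ∈ s, f i) = ∑ i ∈ s, l2 φ (f i) := by
  rw [← l2_conj, l2_sum_left, map_sum]
  exact Finset.sum_congr rfl fun i _ => l2_conj _ _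

theorem l2_weyl_weyl (X : Phase ℝ n) (ψ φ : Wave n) : l2 (weyl X ψ) (weyl X φ) = l2 ψ φ := by
  rw [l2, l2, ← integral_sub_right_eq_self (fun ξ => conj (ψ ξ) * φ ξ) (WithLp.toLp 2 X.2)]
  congr 1; ext ξ
  rw [weyl_apply, weyl_apply, map_mul]
  linear_combination (conj (ψ (ξ - WithLp.toLp 2 X.2)) * φ (ξ - WithLp.toLp 2 X.2)) *
    conj_weylPhase_mul X ξ

theorem weyl_neg_weyl (X : Phase ℝ n) (ψ : Wave n) : weyl (-X) (weyl X ψ) = ψ := by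
  rw [weyl_weyl, sympl_comm, sympl_neg_right, sympl_self]; simp [weyl_zero]

theorem l2_weyl_right (X : Phase ℝ n) (ψ φ : Wave n) : l2 ψ (weyl X φ) = l2 (weyl (-X) ψ) φ := by
  rw [← l2_weyl_weyl (-X), weyl_neg_weyl]

theorem l2_partial (j : Fin n) (ψ φ : Wave n) :
    l2 ψ (partialOp j φ) = - l2 (partialOp j ψ) φ := by
  have h := SchwartzMap.integral_bilinear_lineDerivOp_right_eq_neg_left (μ := volume) ψ φ
    ((ContinuousLinearMap.mul ℝ ℂ).comp (Complex.conjCLE : ℂ →L[ℝ] ℂ))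
    (EuclideanSpace.single j (1 : ℝ))
  exact h

theorem l2_coord (j : Fin n) (ψ φ : Wave n) : l2 ψ (coordOp j φ) = l2 (coordOp j ψ) φ := by
  rw [l2, l2]
  congr 1; ext ξ; simp [coordOp_apply]; ring

theorem Omega_eq (Y : Phase ℂ n) (ψ : Wave n) :
    Omega Y ψ = ∑ j, (Y.1 j • coordOp j ψ + (Complex.I * Y.2 j) • partialOp j ψ) := by
  rw [Omega, sum_apply]
  refine Finset.sum_congr rfl fun j _ => ?_
  rw [sub_apply, smul_apply,
    smul_apply, smul_apply, smul_smul, sub_eq_add_neg,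
    ← neg_smul]
  congr 2
  simp; ring

theorem l2_Omega_right (Y : Phase ℂ n) (ψ φ : Wave n) :
    l2 ψ (Omega Y φ) = l2 (Omega (star Y) ψ) φ := by
  rw [Omega_eq, Omega_eq, l2_sum_right, l2_sum_left]
  refine Finset.sum_congr rfl fun j _ => ?_
  rw [l2_add_right, l2_add_left, l2_smul_right, l2_smul_right, l2_smul_left, l2_smul_left,
    l2_coord, l2_partial]
  simp

theorem hasFDerivAt_weylPhase (X : Phase ℝ n) (ξ v : EuclideanSpace ℝ (Fin n)) :
    DifferentiableAt ℝ (weylPhase X) ξ ∧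
    fderiv ℝ (weylPhase X) ξ v = weylPhase X ξ * (Complex.I * ((∑ j, X.1 j * v j : ℝ) : ℂ)) := by
  have h1 : HasFDerivAt (fun ξ : EuclideanSpace ℝ (Fin n) =>
      (∑ j, X.1 j * ξ j - (1 / 2) * ∑ j, X.1 j * X.2 j : ℝ))
      (∑ j, X.1 j • (EuclideanSpace.proj (𝕜 := ℝ) j : EuclideanSpace ℝ (Fin n) →L[ℝ] ℝ)) ξ := by
    refine HasFDerivAt.sub_const _ ?_
    refine HasFDerivAt.fun_sum fun j _ => ?_
    exact (EuclideanSpace.proj (𝕜 := ℝ) j :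
      EuclideanSpace ℝ (Fin n) →L[ℝ] ℝ).hasFDerivAt.const_mul (X.1 j)
  have h2 := ((Complex.ofRealCLM.hasFDerivAt.comp ξ h1).const_mul Complex.I).cexp
  refine ⟨h2.differentiableAt, ?_⟩
  have h3 : fderiv ℝ (weylPhase X) ξ = _ := h2.fderiv
  rw [h3]
  simp [weylPhase]

theorem Omega_weyl (Y : Phase ℂ n) (X : Phase ℝ n) (ψ : Wave n) :
    Omega Y (weyl X ψ) = weyl X (Omega Y ψ) + sympl Y (toComplex X) • weyl X ψ := by
  ext ξ
  rw [add_apply, smul_apply, weyl_apply, Omega_apply, Omega_apply,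
    weyl_apply]
  have hd : ∀ v, fderiv ℝ (weyl X ψ) ξ v
      = weylPhase X ξ * fderiv ℝ ψ (ξ - WithLp.toLp 2 X.2) v
        + weylPhase X ξ * (Complex.I * ((∑ j, X.1 j * v j : ℝ) : ℂ))
          * ψ (ξ - WithLp.toLp 2 X.2) := by
    intro v
    have e : (weyl X ψ : EuclideanSpace ℝ (Fin n) → ℂ)
        = fun ξ => weylPhase X ξ * ψ (ξ - WithLp.toLp 2 X.2) := funext (weyl_apply X ψ)
    have hψ : HasFDerivAt (fun ξ => ψ (ξ - WithLp.toLp 2 X.2))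
        (fderiv ℝ ψ (ξ - WithLp.toLp 2 X.2)) ξ := by
      have := (ψ.hasFDerivAt (ξ - WithLp.toLp 2 X.2)).comp ξ
        ((hasFDerivAt_id ξ).sub_const (WithLp.toLp 2 X.2))
      simpa [Function.comp_def] using this
    rw [e, ((hasFDerivAt_weylPhase X ξ v).1.hasFDerivAt.fun_mul hψ).fderiv]
    simp [(hasFDerivAt_weylPhase X ξ v).2]
    ring
  simp only [hd, sympl, toComplex, Finset.mul_sum, smul_eq_mul, Finset.sum_mul]
  rw [← Finset.sum_add_distrib]
  refine Finset.sum_congr rfl fun j _ => ?_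
  simp [PiLp.single_apply]
  linear_combination (weylPhase X ξ * ψ (ξ - WithLp.toLp 2 X.2) * Y.2 j * X.1 j) * Complex.I_mul_I

/-- `e^{itΩ(X)} ψ` is the solution of `du/dt = iΩ(X)u`, `u(0) = ψ`. -/
theorem hasDerivAt_weyl (X : Phase ℝ n) (ψ : Wave n) (ξ : EuclideanSpace ℝ (Fin n)) (t : ℝ) :
    HasDerivAt (fun s : ℝ => weyl (s • X) ψ ξ)
      (Complex.I * Omega (toComplex X) (weyl (t • X) ψ) ξ) t := by
  set q : EuclideanSpace ℝ (Fin n) := WithLp.toLp 2 X.2 with hq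
  set a : ℝ := ∑ j, X.1 j * ξ j with ha
  set b : ℝ := ∑ j, X.1 j * X.2 j with hb
  have e1 : (fun s : ℝ => weyl (s • X) ψ ξ) = fun s : ℝ =>
      Complex.exp (Complex.I * ((s * a - (1 / 2) * (s * s * b) : ℝ) : ℂ)) * ψ (ξ - s • q) := by
    funext s
    rw [weyl_apply, weylPhase, ha, hb]
    congr 4
    simp only [Prod.smul_fst, Prod.smul_snd, Pi.smul_apply, smul_eq_mul, Finset.mul_sum]
    congr 1 <;> exact Finset.sum_congr rfl fun j _ => by ring
  have h1 : HasDerivAt (fun s : ℝ => s * a - (1 / 2) * (s * s * b)) (a - t * b) t := by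
    have := ((hasDerivAt_id t).mul_const a).sub
      ((((hasDerivAt_id t).mul (hasDerivAt_id t)).mul_const b).const_mul (1 / 2))
    refine this.congr_deriv ?_
    simp; ring
  have h2 := ((h1.ofReal_comp).const_mul Complex.I).cexp
  have h3 : HasDerivAt (fun s : ℝ => ψ (ξ - s • q)) (fderiv ℝ ψ (ξ - t • q) (-q)) t := by
    have hl : HasDerivAt (fun s : ℝ => ξ - s • q) (-q) t := by
      simpa using ((hasDerivAt_id t).smul_const q).const_sub ξ
    exact (ψ.hasFDerivAt (ξ - t • q)).comp_hasDerivAt t hl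
  rw [e1]
  refine (h2.mul h3).congr_deriv ?_
  have e2 : sympl (toComplex X) (toComplex (t • X)) = 0 := by
    rw [sympl_toComplex]
    norm_cast
    exact Finset.sum_eq_zero fun j _ => by simp; ring
  have e3 : weyl (t • X) (Omega (toComplex X) ψ) ξ
      = Complex.exp (Complex.I * ((t * a - (1 / 2) * (t * t * b) : ℝ) : ℂ))
        * Omega (toComplex X) ψ (ξ - t • q) := by
    rw [weyl_apply, weylPhase, ha, hb]
    congr 4
    simp only [Prod.smul_fst, Prod.smul_snd, Pi.smul_apply, smul_eq_mul, Finset.mul_sum]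
    congr 1 <;> exact Finset.sum_congr rfl fun j _ => by ring
  have e4 : q = ∑ j, X.2 j • EuclideanSpace.single j (1 : ℝ) := by
    ext i
    simp [hq, Pi.single_apply]
  have e5 : Omega (toComplex X) ψ (ξ - t • q)
      = ((a - t * b : ℝ) : ℂ) * ψ (ξ - t • q) + Complex.I * fderiv ℝ ψ (ξ - t • q) q := by
    rw [Omega_apply, Finset.sum_add_distrib]
    congr 1
    · rw [ha, hb, Finset.mul_sum, ← Finset.sum_sub_distrib]
      push_cast
      rw [Finset.sum_mul]
      refine Finset.sum_congr rfl fun j _ => ?_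
      simp [toComplex, hq]
      ring
    · conv_rhs => rw [e4]
      rw [map_sum, Finset.mul_sum]
      refine Finset.sum_congr rfl fun j _ => ?_
      rw [← e4]
      simp [toComplex]
  rw [Omega_weyl, e2, zero_smul, add_zero, e3, e5, map_neg]
  linear_combination (-(Complex.exp (Complex.I * ((t * a - (1 / 2) * (t * t * b) : ℝ) : ℂ))
    * fderiv ℝ ψ (ξ - t • q) q)) * Complex.I_mul_I

end Basic

section Estimates

variable {n : ℕ}

theorem norm_l2_weyl_le (ψ φ : Wave n) :
    ∃ C, ∀ X : Phase ℝ n, ‖l2 ψ (weyl X φ)‖ ≤ C := by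
  refine ⟨∫ ξ, ‖ψ ξ‖ * SchwartzMap.seminorm ℝ 0 0 φ, fun X => ?_⟩
  refine norm_integral_le_of_norm_le (ψ.integrable.norm.mul_const _)
    (Eventually.of_forall fun ξ => ?_)
  rw [weyl_apply, norm_mul, norm_mul, norm_weylPhase, one_mul, RCLike.norm_conj]
  exact mul_le_mul_of_nonneg_left (SchwartzMap.norm_le_seminorm ℝ φ _) (norm_nonneg _)

theorem continuous_l2_weyl (ψ φ : Wave n) :
    Continuous (fun X : Phase ℝ n => l2 ψ (weyl X φ)) := by
  refine continuous_of_dominated (bound := fun ξ => ‖ψ ξ‖ * SchwartzMap.seminorm ℝ 0 0 φ)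
    (fun X => (l2_integrable ψ (weyl X φ)).aestronglyMeasurable)
    (fun X => Eventually.of_forall fun ξ => ?_) (ψ.integrable.norm.mul_const _)
    (Eventually.of_forall fun ξ => ?_)
  · rw [weyl_apply, norm_mul, norm_mul, norm_weylPhase, one_mul, RCLike.norm_conj]
    exact mul_le_mul_of_nonneg_left (SchwartzMap.norm_le_seminorm ℝ φ _) (norm_nonneg _)
  · simp only [weyl_apply, weylPhase]
    have h1 := φ.continuous
    have h2 : Continuous (fun X : Phase ℝ n => φ (ξ - WithLp.toLp 2 X.2)) :=
      h1.comp (continuous_const.sub ((PiLp.continuous_toLp 2 _).comp continuous_snd))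
    fun_prop

theorem sympl_mul_l2 (Y : Phase ℂ n) (X : Phase ℝ n) (ψ φ : Wave n) :
    sympl Y (toComplex X) * l2 ψ (weyl X φ)
      = l2 (Omega (star Y) ψ) (weyl X φ) - l2 ψ (weyl X (Omega Y φ)) := by
  rw [← l2_Omega_right, Omega_weyl, l2_add_right, l2_smul_right]
  ring

theorem norm_le_sum (X : Phase ℝ n) : ‖X‖ ≤ ∑ j, (|X.1 j| + |X.2 j|) := by
  have h : ∀ i, |X.1 i| + |X.2 i| ≤ ∑ j, (|X.1 j| + |X.2 j|) := fun i =>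
    Finset.single_le_sum (f := fun j => |X.1 j| + |X.2 j|) (fun j _ => by positivity)
      (Finset.mem_univ i)
  have h0 : 0 ≤ ∑ j, (|X.1 j| + |X.2 j|) := Finset.sum_nonneg fun j _ => by positivity
  refine max_le ((pi_norm_le_iff_of_nonneg h0).2 fun i => ?_)
    ((pi_norm_le_iff_of_nonneg h0).2 fun i => ?_)
  · rw [Real.norm_eq_abs]; linarith [h i, abs_nonneg (X.2 i)]
  · rw [Real.norm_eq_abs]; linarith [h i, abs_nonneg (X.1 i)]

theorem decay_l2_weyl (m : ℕ) : ∀ ψ φ : Wave n,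
    ∃ C, ∀ X : Phase ℝ n, ‖X‖ ^ m * ‖l2 ψ (weyl X φ)‖ ≤ C := by
  induction m with
  | zero => simpa using norm_l2_weyl_le
  | succ m ih =>
    intro ψ φ
    have key : ∀ Y : Phase ℂ n, ∃ C, ∀ X : Phase ℝ n,
        ‖sympl Y (toComplex X)‖ * (‖X‖ ^ m * ‖l2 ψ (weyl X φ)‖) ≤ C := by
      intro Y
      obtain ⟨C1, h1⟩ := ih (Omega (star Y) ψ) φ
      obtain ⟨C2, h2⟩ := ih ψ (Omega Y φ)
      refine ⟨C1 + C2, fun X => ?_⟩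
      calc _ = ‖X‖ ^ m * ‖sympl Y (toComplex X) * l2 ψ (weyl X φ)‖ := by rw [norm_mul]; ring
        _ ≤ ‖X‖ ^ m * (‖l2 (Omega (star Y) ψ) (weyl X φ)‖ + ‖l2 ψ (weyl X (Omega Y φ))‖) := by
          rw [sympl_mul_l2]
          exact mul_le_mul_of_nonneg_left (norm_sub_le _ _) (by positivity)
        _ ≤ C1 + C2 := by rw [mul_add]; exact add_le_add (h1 X) (h2 X)
    choose K hK using key
    refine ⟨∑ j, (K (0, Pi.single j 1) + K (Pi.single j 1, 0)), fun X => ?_⟩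
    calc ‖X‖ ^ (m + 1) * ‖l2 ψ (weyl X φ)‖
        = ‖X‖ * (‖X‖ ^ m * ‖l2 ψ (weyl X φ)‖) := by ring
      _ ≤ (∑ j, (|X.1 j| + |X.2 j|)) * (‖X‖ ^ m * ‖l2 ψ (weyl X φ)‖) :=
        mul_le_mul_of_nonneg_right (norm_le_sum X) (by positivity)
      _ ≤ _ := by
        rw [Finset.sum_mul]
        refine Finset.sum_le_sum fun j _ => ?_
        rw [add_mul]
        refine add_le_add ?_ ?_
        · refine le_trans (le_of_eq ?_) (hK (0, Pi.single j 1) X)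
          congr 1
          simp [sympl, toComplex, Pi.single_apply]
        · refine le_trans (le_of_eq ?_) (hK (Pi.single j 1, 0) X)
          congr 1
          simp [sympl, toComplex, Pi.single_apply]

theorem integrable_exp_neg_norm_sq {V : Type*} [NormedAddCommGroup V] [NormedSpace ℝ V]
    [FiniteDimensional ℝ V] [MeasurableSpace V] [BorelSpace V] (μ : Measure V)
    [μ.IsAddHaarMeasure] {t : ℝ} (ht : 0 < t) :
    Integrable (fun x : V => Real.exp (-t * ‖toEuclidean x‖ ^ 2)) μ := by
  have h1 : Integrable (fun y : EuclideanSpace ℝ (Fin (Module.finrank ℝ V)) =>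
      Real.exp (-t * ‖y‖ ^ 2)) volume := by
    have := (GaussianFourier.integrable_cexp_neg_mul_sq_norm_add (b := (t : ℂ)) (by simpa using ht)
      0 (0 : EuclideanSpace ℝ (Fin (Module.finrank ℝ V)))).norm
    refine this.congr (Eventually.of_forall fun y => ?_)
    simp only [Complex.norm_exp]
    congr 1
    simp [← Complex.ofReal_pow]
  have : (μ.map (toEuclidean (E := V))).IsAddHaarMeasure :=
    ContinuousLinearEquiv.isAddHaarMeasure_map toEuclidean μ
  have h2 : Integrable (fun y : EuclideanSpace ℝ (Fin (Module.finrank ℝ V)) =>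
      Real.exp (-t * ‖y‖ ^ 2)) (μ.map (toEuclidean (E := V))) := by
    rw [Measure.isAddLeftInvariant_eq_smul (μ.map (toEuclidean (E := V))) volume]
    exact h1.smul_measure_nnreal
  exact (integrable_map_measure h2.aestronglyMeasurable
    toEuclidean.continuous.measurable.aemeasurable).1 h2

/-- The integral of an integrable positive-definite function is nonnegative. -/
theorem re_integral_nonneg {V : Type*} [NormedAddCommGroup V] [NormedSpace ℝ V]
    [FiniteDimensional ℝ V] [MeasurableSpace V] [BorelSpace V] (μ : Measure V)
    [μ.IsAddHaarMeasure] {H : Type*} [NormedAddCommGroup H] [InnerProductSpace ℂ H]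
    [CompleteSpace H] (v : V → H) (f : V → ℂ) (hfc : Continuous f) (hf : Integrable f μ)
    (hv : ∀ x y, inner ℂ (v x) (v y) = f (y - x)) : 0 ≤ (∫ x, f x ∂μ).re := by
  have hvn : ∀ x, ‖v x‖ ^ 2 = (f 0).re := fun x => by
    rw [← inner_self_eq_norm_sq (𝕜 := ℂ), hv, sub_self]; rfl
  have hvc : Continuous v := by
    rw [continuous_iff_continuousAt]
    intro x
    rw [ContinuousAt, tendsto_iff_norm_sub_tendsto_zero]
    have e : ∀ y, ‖v y - v x‖ = √(2 * (f 0).re - 2 * (f (x - y)).re) := fun y => by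
      rw [← Real.sqrt_sq (norm_nonneg _), @norm_sub_sq ℂ, hvn, hvn, hv]
      congr 1
      simp only [RCLike.re_to_complex]
      ring
    simp only [e]
    have : Tendsto (fun y => √(2 * (f 0).re - 2 * (f (x - y)).re)) (𝓝 x)
        (𝓝 (√(2 * (f 0).re - 2 * (f (x - x)).re))) := by
      refine Continuous.tendsto (f := fun y => √(2 * (f 0).re - 2 * (f (x - y)).re)) ?_ x
      fun_prop
    simpa using this
  have hvb : ∀ x, ‖v x‖ ≤ √((f 0).re) := fun x => by
    rw [← hvn x, Real.sqrt_sq (norm_nonneg _)]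
  have step : ∀ t : ℝ, 0 < t →
      0 ≤ (∫ x, f x * (Real.exp (-(t / 2) * ‖toEuclidean x‖ ^ 2) : ℂ) ∂μ).re := by
    intro t ht
    set g : V → ℝ := fun x => Real.exp (-t * ‖toEuclidean x‖ ^ 2) with hg
    have hgi : Integrable g μ := integrable_exp_neg_norm_sq μ ht
    have hgc : Continuous g := by
      have := (toEuclidean (E := V)).continuous
      fun_prop
    have hg0 : ∀ x, 0 ≤ g x := fun x => (Real.exp_pos _).le
    have hg1 : ∀ x, g x ≤ 1 := fun x => Real.exp_le_one_iff.2 (by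
      have := mul_nonneg ht.le (sq_nonneg ‖toEuclidean x‖); linarith)
    have hgv : Integrable (fun x => ((g x : ℝ) : ℂ) • v x) μ := by
      refine (hgi.mul_const (√((f 0).re))).mono'
        ((Complex.continuous_ofReal.comp hgc).smul hvc).aestronglyMeasurable
        (Eventually.of_forall fun x => ?_)
      rw [norm_smul, Complex.norm_real, Real.norm_of_nonneg (hg0 x)]
      exact mul_le_mul_of_nonneg_left (hvb x) (hg0 x)
    set c : ℝ := ∫ x, Real.exp (-(2 * t) * ‖toEuclidean x‖ ^ 2) ∂μ with hc
    have hcpos : 0 < c := integral_exp_pos (integrable_exp_neg_norm_sq μ (by positivity))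
    have hgg : ∀ x, ∫ y, g (x + y) * g y ∂μ
        = Real.exp (-(t / 2) * ‖toEuclidean x‖ ^ 2) * c := by
      intro x
      rw [hc, ← integral_add_right_eq_self
        (fun y => Real.exp (-(2 * t) * ‖toEuclidean y‖ ^ 2)) ((1 / 2 : ℝ) • x),
        ← integral_const_mul]
      congr 1
      funext y
      simp only [hg, ← Real.exp_add, map_add, map_smul]
      congr 1
      simp only [@norm_add_sq_real, norm_smul, real_inner_smul_right, real_inner_comm,
        Real.norm_eq_abs]
      rw [abs_of_pos (by norm_num : (0 : ℝ) < 1 / 2)]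
      rw [real_inner_comm]
      ring
    have hI : inner ℂ (∫ x, ((g x : ℝ) : ℂ) • v x ∂μ) (∫ x, ((g x : ℝ) : ℂ) • v x ∂μ)
        = (∫ x, f x * (Real.exp (-(t / 2) * ‖toEuclidean x‖ ^ 2) : ℂ) ∂μ) * c := by
      have h1 : ∀ y, inner ℂ (∫ x, ((g x : ℝ) : ℂ) • v x ∂μ) (((g y : ℝ) : ℂ) • v y)
          = ∫ x, ((g (x + y) : ℝ) : ℂ) * (g y : ℝ) * f (-x) ∂μ := by
        intro y
        rw [← inner_conj_symm, ← integral_inner hgv, ← integral_conj,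
          ← integral_add_right_eq_self _ y]
        congr 1
        funext x
        rw [inner_conj_symm, inner_smul_left, inner_smul_right, hv, Complex.conj_ofReal]
        rw [show y - (x + y) = -x by abel]
        ring
      rw [← integral_inner hgv]
      simp only [h1]
      have hint : Integrable (Function.uncurry
          (fun (y x : V) => ((g (x + y) : ℝ) : ℂ) * (g y : ℝ) * f (-x))) (μ.prod μ) := by
        have := hgi.mul_prod hf.comp_neg.norm
        refine this.mono' ?_ (Eventually.of_forall fun p => ?_)
        · refine Continuous.aestronglyMeasurable ?_
          simp only [Function.uncurry_def]
          fun_prop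
        · simp only [Function.uncurry_def, norm_mul, Complex.norm_real,
            Real.norm_of_nonneg (hg0 _)]
          refine mul_le_mul_of_nonneg_right ?_ (norm_nonneg _)
          exact mul_le_of_le_one_left (hg0 _) (hg1 _)
      rw [integral_integral_swap hint, ← integral_neg_eq_self, ← integral_mul_const]
      congr 1
      funext x
      rw [integral_mul_const]
      have : ∫ y, ((g (-x + y) : ℝ) : ℂ) * (g y : ℝ) ∂μ
          = ((∫ y, g (-x + y) * g y ∂μ : ℝ) : ℂ) := by
        rw [← integral_complex_ofReal]; simp
      rw [this, hgg, neg_neg, map_neg, norm_neg]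
      push_cast
      ring
    have h2 := inner_self_nonneg (𝕜 := ℂ) (x := ∫ x, ((g x : ℝ) : ℂ) • v x ∂μ)
    rw [hI, RCLike.re_to_complex, Complex.re_mul_ofReal] at h2
    exact nonneg_of_mul_nonneg_left h2 hcpos
  have hlim : Tendsto (fun m : ℕ => ∫ x, f x *
      (Real.exp (-((1 / ((m : ℝ) + 1)) / 2) * ‖toEuclidean x‖ ^ 2) : ℂ) ∂μ) atTop
      (𝓝 (∫ x, f x ∂μ)) := by
    refine tendsto_integral_of_dominated_convergence (fun x => ‖f x‖) (fun m => ?_) hf.norm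
      (fun m => Eventually.of_forall fun x => ?_) (Eventually.of_forall fun x => ?_)
    · have := (toEuclidean (E := V)).continuous
      exact Continuous.aestronglyMeasurable (by fun_prop)
    · rw [norm_mul, Complex.norm_real, Real.norm_of_nonneg (Real.exp_pos _).le]
      refine mul_le_of_le_one_right (norm_nonneg _) (Real.exp_le_one_iff.2 ?_)
      have : 0 ≤ (1 / ((m : ℝ) + 1)) / 2 * ‖toEuclidean x‖ ^ 2 := by positivity
      linarith
    · have h3 : Tendsto (fun m : ℕ => (1 / ((m : ℝ) + 1))) atTop (𝓝 0) :=
        tendsto_one_div_add_atTop_nhds_zero_nat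
      have h4 : Continuous (fun s : ℝ => f x *
        (Real.exp (-(s / 2) * ‖toEuclidean x‖ ^ 2) : ℂ)) := by fun_prop
      simpa [Function.comp_def] using (h4.tendsto 0).comp h3
  exact ge_of_tendsto' ((Complex.continuous_re.tendsto _).comp hlim)
    fun m => step _ (by positivity)

end Estimates

/-- A system of linear constraints: a `k`-dimensional isotropic plane `𝓛_k` in the phase space
`ℝ^{2n}`, together with a shift-invariant (Lebesgue) measure `μ` on it. -/
structure ConstraintPlane (n k : ℕ) where
  plane : Submodule ℝ (Phase ℝ n)
  finrank_plane : Module.finrank ℝ plane = k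
  isotropic : ∀ X ∈ plane, ∀ X' ∈ plane, sympl X X' = 0
  μ : Measure plane
  isAddHaar : μ.IsAddHaarMeasure

attribute [instance] ConstraintPlane.isAddHaar

namespace ConstraintPlane

variable {n k : ℕ} (C : ConstraintPlane n k)

/-- The form `⟨ψ, φ⟩ = ∫_{𝓛_k} (ψ, e^{iΩ(X)} φ) dμ(X)`. -/
def form (ψ φ : Wave n) : ℂ := ∫ X : C.plane, l2 ψ (weyl (X : Phase ℝ n) φ) ∂C.μ

theorem continuous_integrand (ψ φ : Wave n) :
    Continuous (fun X : C.plane => l2 ψ (weyl (X : Phase ℝ n) φ)) :=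
  (continuous_l2_weyl ψ φ).comp continuous_subtype_val

theorem integrable_integrand (ψ φ : Wave n) :
    Integrable (fun X : C.plane => l2 ψ (weyl (X : Phase ℝ n) φ)) C.μ := by
  obtain ⟨C1, h1⟩ := norm_l2_weyl_le ψ φ
  obtain ⟨C2, h2⟩ := decay_l2_weyl (0 + C.μ.integrablePower) ψ φ
  have hm := (C.continuous_integrand ψ φ).aestronglyMeasurable (μ := C.μ)
  have := integrable_of_le_of_pow_mul_le (μ := C.μ) (k := 0)
    (f := fun X : C.plane => l2 ψ (weyl (X : Phase ℝ n) φ)) (fun X => h1 X) (fun X => h2 X) hm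
  simp only [pow_zero, one_mul] at this
  exact (integrable_norm_iff hm).1 this

theorem form_add_left (ψ ψ' φ : Wave n) :
    C.form (ψ + ψ') φ = C.form ψ φ + C.form ψ' φ := by
  simp only [form, l2_add_left]
  exact integral_add (C.integrable_integrand _ _) (C.integrable_integrand _ _)

theorem form_smul_left (c : ℂ) (ψ φ : Wave n) : C.form (c • ψ) φ = conj c * C.form ψ φ := by
  simp only [form, l2_smul_left]
  exact integral_const_mul _ _

theorem form_conj (ψ φ : Wave n) : conj (C.form φ ψ) = C.form ψ φ := by
  have : ProperSpace C.plane := FiniteDimensional.proper ℝ C.plane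
  rw [form, form, ← integral_conj, ← integral_neg_eq_self]
  congr 1
  funext X
  rw [l2_conj, l2_weyl_right]
  simp

theorem form_nonneg (ψ : Wave n) : 0 ≤ (C.form ψ ψ).re := by
  refine re_integral_nonneg C.μ (fun X : C.plane => (weyl (X : Phase ℝ n) ψ).toLp 2 volume)
    (fun X : C.plane => l2 ψ (weyl (X : Phase ℝ n) ψ)) (C.continuous_integrand ψ ψ)
    (C.integrable_integrand ψ ψ) fun X X' => ?_
  have h : inner ℂ ((weyl (X : Phase ℝ n) ψ).toLp 2 volume)
      ((weyl (X' : Phase ℝ n) ψ).toLp 2 volume)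
      = l2 (weyl (X : Phase ℝ n) ψ) (weyl (X' : Phase ℝ n) ψ) := by
    refine (SchwartzMap.inner_toL2_toL2_eq _ _ volume).trans ?_
    rw [l2]
    congr 1
    funext ξ
    rw [RCLike.inner_apply, mul_comm]
  rw [h, ← l2_weyl_weyl (-(X : Phase ℝ n)), weyl_neg_weyl, weyl_weyl, sympl_comm,
    sympl_neg_right, C.isotropic _ X'.2 _ X.2]
  simp [sub_eq_neg_add]

/-- The Schwartz space `𝓢(ℝⁿ, 𝓛_k)`, that is `𝓢(ℝⁿ)` with the inner product `form`. -/
def PreState (_C : ConstraintPlane n k) : Type := Wave n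

instance : AddCommGroup C.PreState := inferInstanceAs (AddCommGroup (Wave n))

instance : Module ℂ C.PreState := inferInstanceAs (Module ℂ (Wave n))

/-- The form is Hermitian and positive semidefinite. -/
@[reducible]
def core : PreInnerProductSpace.Core ℂ C.PreState where
  inner ψ φ := C.form ψ φ
  conj_inner_symm ψ φ := C.form_conj ψ φ
  re_inner_nonneg ψ := C.form_nonneg ψ
  add_left ψ ψ' φ := C.form_add_left ψ ψ' φ
  smul_left ψ φ c := C.form_smul_left c ψ φ

instance : SeminormedAddCommGroup C.PreState :=
  @InnerProductSpace.Core.toSeminormedAddCommGroup ℂ C.PreState _ _ _ C.core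

instance : InnerProductSpace ℂ C.PreState := InnerProductSpace.ofCore C.core

theorem inner_eq (ψ φ : C.PreState) : inner ℂ ψ φ = C.form ψ φ := rfl

/-- The quotient `𝓢(ℝⁿ, 𝓛_k)/∼` by the vectors of zero norm. -/
abbrev Quot : Type := SeparationQuotient C.PreState

/-- The class `[ψ]` in the quotient. -/
def cls (ψ : Wave n) : C.Quot := SeparationQuotient.mk (ψ : C.PreState)

theorem norm_eq (ψ : C.PreState) : ‖ψ‖ = √(C.form ψ ψ).re := rfl

theorem inseparable_iff (ψ φ : C.PreState) : Inseparable ψ φ ↔ ‖ψ - φ‖ = 0 := by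
  rw [Metric.inseparable_iff, dist_eq_norm]

theorem norm_eq_zero_iff (ψ : C.PreState) : ‖ψ‖ = 0 ↔ C.form ψ ψ = 0 := by
  rw [← C.inner_eq, inner_self_eq_norm_sq_to_K]
  simp

theorem cls_eq_cls_iff (ψ φ : Wave n) : C.cls ψ = C.cls φ ↔ C.form (ψ - φ) (ψ - φ) = 0 :=
  (SeparationQuotient.mk_eq_mk.trans (C.inseparable_iff ψ φ)).trans (C.norm_eq_zero_iff _)

/-- The physical Hilbert space: the completion of the quotient. -/
abbrev PhysSpace : Type := UniformSpace.Completion C.Quot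

/-- The skew-orthogonal complement `𝓛_k^{⊥ω}` in `ℝ^{2n}`. -/
def skewPerp : Set (Phase ℝ n) := {Y | ∀ X ∈ C.plane, sympl Y X = 0}

/-- The complexification `𝓛_k^ℂ ⊂ ℂ^{2n}`. -/
def planeC : Submodule ℂ (Phase ℂ n) := Submodule.span ℂ (toComplex '' (C.plane : Set (Phase ℝ n)))

/-- The skew-orthogonal complement `(𝓛_k^ℂ)^{⊥ω}` in `ℂ^{2n}`. -/
def skewPerpC : Set (Phase ℂ n) := {Y | ∀ X ∈ C.planeC, sympl Y X = 0}

theorem form_weyl_weyl {Y : Phase ℝ n} (hY : Y ∈ C.skewPerp) (ψ φ : Wave n) :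
    C.form (weyl Y ψ) (weyl Y φ) = C.form ψ φ := by
  rw [form, form]
  congr 1
  funext X
  have h : weyl (X : Phase ℝ n) (weyl Y φ) = weyl Y (weyl (X : Phase ℝ n) φ) := by
    rw [weyl_weyl, weyl_weyl, sympl_comm, hY _ X.2, add_comm]
    simp
  rw [h, l2_weyl_weyl]

theorem form_Omega {Y : Phase ℂ n} (hY : Y ∈ C.skewPerpC) (ψ φ : Wave n) :
    C.form ψ (Omega Y φ) = C.form (Omega (star Y) ψ) φ := by
  rw [form, form]
  congr 1
  funext X
  have h := Omega_weyl Y (X : Phase ℝ n) φ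
  rw [hY _ (Submodule.subset_span ⟨X, X.2, rfl⟩), zero_smul, add_zero] at h
  rw [← h, l2_Omega_right]

/-- `e^{iΩ(Y)}`, `Y ∈ 𝓛_k^{⊥ω}`, on classes: `e^{iΩ(Y)} [ψ] = [e^{iΩ(Y)} ψ]`. -/
def weylQuot (Y : C.skewPerp) : C.Quot →ₗᵢ[ℂ] C.Quot where
  toFun := SeparationQuotient.lift (fun ψ : C.PreState => C.cls (weyl (Y : Phase ℝ n) ψ)) (by
    intro ψ φ h
    have h' := (C.cls_eq_cls_iff ψ φ).1 (SeparationQuotient.mk_eq_mk.2 h)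
    rw [cls_eq_cls_iff]
    have e : weyl (Y : Phase ℝ n) (ψ : Wave n) - weyl (Y : Phase ℝ n) (φ : Wave n)
      = weyl (Y : Phase ℝ n) ((ψ : Wave n) - φ) := (map_sub _ _ _).symm
    exact (congrArg (fun a => C.form a a) e).trans ((C.form_weyl_weyl Y.2 _ _).trans h'))
  map_add' a b := by
    obtain ⟨ψ, rfl⟩ := SeparationQuotient.surjective_mk a
    obtain ⟨φ, rfl⟩ := SeparationQuotient.surjective_mk b
    exact congrArg C.cls (map_add (weyl (Y : Phase ℝ n)) (ψ : Wave n) φ)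
  map_smul' c a := by
    obtain ⟨ψ, rfl⟩ := SeparationQuotient.surjective_mk a
    exact congrArg C.cls (map_smul (weyl (Y : Phase ℝ n)) c (ψ : Wave n))
  norm_map' a := by
    obtain ⟨ψ, rfl⟩ := SeparationQuotient.surjective_mk a
    exact congrArg (fun z : ℂ => √z.re) (C.form_weyl_weyl Y.2 ψ ψ)

/-- `e^{iΩ(Y)}`, `Y ∈ 𝓛_k^{⊥ω}`, extended by continuity to the physical Hilbert space. -/
def weylPhys (Y : C.skewPerp) : C.PhysSpace →L[ℂ] C.PhysSpace :=
  (C.weylQuot Y).toContinuousLinearMap.completion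

theorem weylPhys_cls (Y : C.skewPerp) (ψ : Wave n) :
    C.weylPhys Y (C.cls ψ : C.PhysSpace) = (C.cls (weyl (Y : Phase ℝ n) ψ) : C.PhysSpace) :=
  ContinuousLinearMap.completion_apply_coe _ _

/-- `Ω(Y)`, `Y ∈ (𝓛_k^ℂ)^{⊥ω}`, on classes: `Ω(Y) [ψ] = [Ω(Y) ψ]`. -/
def omegaQuot (Y : C.skewPerpC) : C.Quot →ₗ[ℂ] C.Quot where
  toFun := SeparationQuotient.lift (fun ψ : C.PreState => C.cls (Omega (Y : Phase ℂ n) ψ)) (by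
    intro ψ φ h
    have h' := (C.cls_eq_cls_iff ψ φ).1 (SeparationQuotient.mk_eq_mk.2 h)
    rw [cls_eq_cls_iff]
    have e : Omega (Y : Phase ℂ n) (ψ : Wave n) - Omega (Y : Phase ℂ n) (φ : Wave n)
      = Omega (Y : Phase ℂ n) ((ψ : Wave n) - φ) := (map_sub _ _ _).symm
    refine (congrArg (fun a => C.form a a) e).trans ((C.form_Omega Y.2 _ _).trans ?_)
    set χ : C.PreState := Omega (star (Y : Phase ℂ n)) (Omega (Y : Phase ℂ n) ((ψ : Wave n) - φ))
    have h0 : ‖(ψ - φ : C.PreState)‖ = 0 := (C.inseparable_iff ψ φ).1 h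
    have h1 : ‖inner ℂ χ (ψ - φ : C.PreState)‖ ≤ ‖χ‖ * ‖(ψ - φ : C.PreState)‖ :=
      norm_inner_le_norm _ _
    rw [h0, mul_zero] at h1
    exact norm_le_zero_iff.1 h1)
  map_add' a b := by
    obtain ⟨ψ, rfl⟩ := SeparationQuotient.surjective_mk a
    obtain ⟨φ, rfl⟩ := SeparationQuotient.surjective_mk b
    exact congrArg C.cls (map_add (Omega (Y : Phase ℂ n)) (ψ : Wave n) φ)
  map_smul' c a := by
    obtain ⟨ψ, rfl⟩ := SeparationQuotient.surjective_mk a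
    exact congrArg C.cls (map_smul (Omega (Y : Phase ℂ n)) c (ψ : Wave n))

theorem omegaQuot_cls (Y : C.skewPerpC) (ψ : Wave n) :
    C.omegaQuot Y (C.cls ψ) = C.cls (Omega (Y : Phase ℂ n) ψ) := rfl

theorem star_mem_skewPerpC {Y : Phase ℂ n} (hY : Y ∈ C.skewPerpC) : star Y ∈ C.skewPerpC := by
  intro X hX
  have h1 : ∀ Z W : Phase ℂ n, sympl (star Z) W = star (sympl Z (star W)) := by
    intro Z W
    simp [sympl, mul_comm]
  have h2 : star X ∈ C.planeC := by
    refine Submodule.span_induction (p := fun X _ => star X ∈ C.planeC) ?_ ?_ ?_ ?_ hX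
    · rintro _ ⟨W, hW, rfl⟩
      refine Submodule.subset_span ⟨W, hW, ?_⟩
      ext j <;> simp [toComplex]
    · simp
    · intro a b _ _ ha hb
      rw [star_add]
      exact add_mem ha hb
    · intro c a _ ha
      rw [star_smul]
      exact C.planeC.smul_mem _ ha
  rw [h1, hY _ h2, star_zero]

/-- The H-germ `ř` of `ψ`: the `Y` for which `Ω(Y)` acts on classes and `‖Ω(Y) [ψ]‖ = 0`. -/
def germ (ψ : Wave n) : Set (Phase ℂ n) :=
  {Y | ∃ hY : Y ∈ C.skewPerpC, ‖C.omegaQuot ⟨Y, hY⟩ (C.cls ψ)‖ = 0}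

/-- The complex conjugate `ř* = {Y* | Y ∈ ř}` of the H-germ. -/
def conjGerm (ψ : Wave n) : Set (Phase ℂ n) := {Z | ∃ Y ∈ C.germ ψ, Z = star Y}

theorem conjGerm_subset (ψ : Wave n) : C.conjGerm ψ ⊆ C.skewPerpC := by
  rintro _ ⟨Y, ⟨hY, -⟩, rfl⟩
  exact C.star_mem_skewPerpC hY

/-- `Ω(Z)`, `Z ∈ ř*`, on classes. -/
def creation (ψ : Wave n) (Z : C.conjGerm ψ) : C.Quot →ₗ[ℂ] C.Quot :=
  C.omegaQuot ⟨Z, C.conjGerm_subset ψ Z.2⟩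

end ConstraintPlane

/-- `ψ` is the Gaussian function `c exp ((i/2) ∑ ξ_j A_{jl} ξ_l)`, `c ≠ 0`, where `A` is a complex
symmetric matrix with positive definite imaginary part. -/
def IsGaussian {n : ℕ} (c : ℂ) (A : Matrix (Fin n) (Fin n) ℂ) (ψ : Wave n) : Prop :=
  c ≠ 0 ∧ A.IsSymm ∧ (A.map Complex.im).PosDef ∧
    ∀ ξ, ψ ξ = c * Complex.exp (Complex.I / 2 * ∑ j, ∑ l, (ξ j : ℂ) * A j l * (ξ l : ℂ))

end LinearConstraint

end

/-! Write W(Y) for `weyl Y`, L for the constraint plane, g for a nonzero wave function. Three facts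
carry the proof.

The matrix elements of W satisfy the Moyal orthogonality relation over the full phase space
(`integral_l2_weyl_mul`). Integrated over L, it expresses ⟨φ,ψ⟩ up to the nonzero constant (2π)^n
(g,g) as ∫ (W(Y)g,ψ) ⟨φ,W(Y)g⟩ dY. So every class is a weak superposition of the classes [W(Y)g]
with Y unrestricted, and these are total in the physical space (`eq_top_of_weyl_mem`).

A Gaussian carries a complex structure J on ℝ^{2n}, with ω(JX,X) > 0 for X ≠ 0 and Ω(JX)ψ = iΩ(X)ψ.
For X in L, Ω(X) vanishes on classes, so translating by JX changes [W(Y₀)ψ], Y₀ in the skew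
complement, only by a scalar (`cls_weyl_complexStructure`). Positivity of ω(J·,·) on L splits any Y
as JX + Y₀ with X in L and Y₀ in the skew complement. Totality for all Y therefore reduces to Y in
the skew complement, which is the first claim.

For the second claim, an element Y of the skew complement can be shifted by an element of L, without
changing [W(Y)ψ], to some U for which JU also lies in the skew complement. Then Z = (U + iJU)/2
annihilates ψ and Ω(U) = Ω(Z) + Ω(Z*). Normal ordering puts the powers Ω(U)^m ψ in the span of the
vectors Ω(Z*)^p ψ, and moment bounds of Gaussian type make the exponential series of iΩ(U) on ψ
converge to [W(U)ψ]. -/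

namespace LinearConstraint

/-! ### Decay and differentiability of Weyl matrix elements -/

section Decay

variable {n : ℕ}

theorem sympl_smul_right (X X' : Phase ℝ n) (s : ℝ) : sympl X (s • X') = s * sympl X X' := by
  simp only [sympl, Finset.mul_sum]
  exact Finset.sum_congr rfl fun j _ => by simp; ring

theorem sympl_add_right (X X' X'' : Phase ℝ n) :
    sympl X (X' + X'') = sympl X X' + sympl X X'' := by
  simp only [sympl, ← Finset.sum_add_distrib]
  exact Finset.sum_congr rfl fun j _ => by simp; ring

theorem sympl_smul_left (X X' : Phase ℝ n) (s : ℝ) : sympl (s • X) X' = s * sympl X X' := by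
  rw [sympl_comm, sympl_smul_right, sympl_comm X]; ring

theorem sympl_add_left (X X' X'' : Phase ℝ n) :
    sympl (X + X') X'' = sympl X X'' + sympl X' X'' := by
  rw [sympl_comm, sympl_add_right, sympl_comm X, sympl_comm X']; ring

theorem norm_exp_I_div_two_mul (r : ℝ) : ‖Complex.exp (Complex.I / 2 * (r : ℂ))‖ = 1 := by
  rw [show Complex.I / 2 * (r : ℂ) = ((r / 2 : ℝ) : ℂ) * Complex.I by push_cast; ring,
    Complex.norm_exp_ofReal_mul_I]

theorem norm_l2_weyl_weyl (X X' : Phase ℝ n) (ψ φ : Wave n) :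
    ‖l2 ψ (weyl X (weyl X' φ))‖ = ‖l2 ψ (weyl (X + X') φ)‖ := by
  rw [weyl_weyl, l2_smul_right, norm_mul, norm_exp_I_div_two_mul, one_mul]

/-- Rapid decay in X + Y becomes decay in X, at the price of polynomial growth in Y, through 1 + ‖X‖
≤ (1 + ‖X+Y‖)(1 + ‖Y‖). It supplies the integrable majorants over the plane for differentiation
under the integral and for Fubini. -/
theorem norm_l2_weyl_add_le (m : ℕ) (ψ φ : Wave n) :
    ∃ C, ∀ X Y : Phase ℝ n,
      ‖l2 ψ (weyl (X + Y) φ)‖ ≤ C * (1 + ‖Y‖) ^ m * ((1 + ‖X‖) ^ m)⁻¹ := by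
  obtain ⟨C1, h1⟩ := norm_l2_weyl_le ψ φ
  obtain ⟨C2, h2⟩ := decay_l2_weyl m ψ φ
  refine ⟨2 ^ (m - 1) * (C1 + C2), fun X Y => ?_⟩
  have h3 : (1 + ‖X + Y‖) ^ m * ‖l2 ψ (weyl (X + Y) φ)‖ ≤ 2 ^ (m - 1) * (C1 + C2) := by
    have := add_pow_le zero_le_one (norm_nonneg (X + Y)) m
    calc _ ≤ 2 ^ (m - 1) * (1 ^ m + ‖X + Y‖ ^ m) * ‖l2 ψ (weyl (X + Y) φ)‖ := by gcongr
      _ = 2 ^ (m - 1) * (‖l2 ψ (weyl (X + Y) φ)‖ + ‖X + Y‖ ^ m * ‖l2 ψ (weyl (X + Y) φ)‖) := by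
        ring
      _ ≤ _ := by gcongr; exacts [h1 _, h2 _]
  have h4 : 1 + ‖X‖ ≤ (1 + ‖X + Y‖) * (1 + ‖Y‖) := by
    have : ‖X‖ ≤ ‖X + Y‖ + ‖Y‖ := by simpa using norm_sub_le (X + Y) Y
    nlinarith [mul_nonneg (norm_nonneg (X + Y)) (norm_nonneg Y)]
  rw [← div_eq_mul_inv, le_div_iff₀ (by positivity)]
  calc _ ≤ ‖l2 ψ (weyl (X + Y) φ)‖ * ((1 + ‖X + Y‖) * (1 + ‖Y‖)) ^ m := by gcongr
    _ = (1 + ‖X + Y‖) ^ m * ‖l2 ψ (weyl (X + Y) φ)‖ * (1 + ‖Y‖) ^ m := by rw [mul_pow]; ring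
    _ ≤ _ := by gcongr

theorem integrable_inv_one_add_norm_pow {V : Type*} [NormedAddCommGroup V] [NormedSpace ℝ V]
    [FiniteDimensional ℝ V] [MeasurableSpace V] [BorelSpace V] (μ : Measure V)
    [μ.IsAddHaarMeasure] {m : ℕ} (hm : Module.finrank ℝ V < m) :
    Integrable (fun x : V => ((1 + ‖x‖) ^ m)⁻¹) μ := by
  refine (integrable_one_add_norm (μ := μ) (r := m) (by exact_mod_cast hm)).congr
    (Eventually.of_forall fun x => ?_)
  simp only [Real.rpow_neg (by positivity : (0 : ℝ) ≤ 1 + ‖x‖), Real.rpow_natCast]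

theorem weyl_Omega_self (Y : Phase ℝ n) (s : ℝ) (ψ : Wave n) :
    Omega (toComplex Y) (weyl (s • Y) ψ) = weyl (s • Y) (Omega (toComplex Y) ψ) := by
  rw [Omega_weyl, sympl_toComplex, sympl_smul_right, sympl_self]
  simp

theorem norm_weyl_apply_le (X : Phase ℝ n) (ψ : Wave n) (ξ) :
    ‖weyl X ψ ξ‖ ≤ SchwartzMap.seminorm ℝ 0 0 ψ := by
  rw [weyl_apply, norm_mul, norm_weylPhase, one_mul]
  exact SchwartzMap.norm_le_seminorm ℝ ψ _

/-- Ω(Y) commutes with W(tY), so the pointwise derivative is a Weyl translate of one fixed wave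
function; its supremum does not depend on t, which gives the majorant. -/
theorem hasDerivAt_l2_weyl (φ ψ : Wave n) (Y : Phase ℝ n) (s : ℝ) :
    HasDerivAt (fun t : ℝ => l2 φ (weyl (t • Y) ψ))
      (Complex.I * l2 φ (weyl (s • Y) (Omega (toComplex Y) ψ))) s := by
  have key := hasDerivAt_integral_of_dominated_loc_of_deriv_le (μ := volume) (𝕜 := ℝ)
    (F := fun t ξ => conj (φ ξ) * weyl (t • Y) ψ ξ)
    (F' := fun t ξ => conj (φ ξ) * (Complex.I * weyl (t • Y) (Omega (toComplex Y) ψ) ξ))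
    (bound := fun ξ => ‖φ ξ‖ * SchwartzMap.seminorm ℝ 0 0 (Omega (toComplex Y) ψ))
    (x₀ := s) (s := Set.univ) Filter.univ_mem
    (Eventually.of_forall fun t => (l2_integrable φ (weyl (t • Y) ψ)).aestronglyMeasurable)
    (l2_integrable _ _) ?_ (Eventually.of_forall fun ξ t _ => ?_) (φ.integrable.norm.mul_const _)
    (Eventually.of_forall fun ξ t _ => ?_)
  · refine key.2.congr_deriv ?_
    rw [← l2_smul_right]
    rfl
  · exact (l2_integrable φ (Complex.I • weyl (s • Y) (Omega (toComplex Y) ψ))).aestronglyMeasurable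
  · rw [norm_mul, norm_mul, Complex.norm_I, one_mul, RCLike.norm_conj]
    gcongr
    exact norm_weyl_apply_le _ _ _
  · have := (hasDerivAt_weyl Y ψ ξ t).const_mul (conj (φ ξ))
    rwa [weyl_Omega_self] at this

end Decay

/-! ### Differentiating the physical form; the plane acts trivially on classes -/

namespace ConstraintPlane

variable {n k : ℕ} (C : ConstraintPlane n k)

theorem form_add_right (ψ φ φ' : Wave n) :
    C.form ψ (φ + φ') = C.form ψ φ + C.form ψ φ' := by
  rw [← form_conj, form_add_left, map_add, form_conj, form_conj]

theorem form_smul_right (c : ℂ) (ψ φ : Wave n) : C.form ψ (c • φ) = c * C.form ψ φ := by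
  rw [← form_conj, form_smul_left, map_mul, form_conj, Complex.conj_conj]

theorem hasDerivAt_form_weyl (φ ψ : Wave n) (Y : Phase ℝ n) (s : ℝ) :
    HasDerivAt (fun t : ℝ => C.form φ (weyl (t • Y) ψ))
      (Complex.I * C.form φ (weyl (s • Y) (Omega (toComplex Y) ψ))) s := by
  set χ := Omega (toComplex Y) ψ
  obtain ⟨K, hK⟩ := norm_l2_weyl_add_le (Module.finrank ℝ C.plane + 1) φ χ
  set m := Module.finrank ℝ C.plane + 1
  have hK0 : 0 ≤ K := by
    have := (norm_nonneg _).trans (hK 0 0)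
    simpa using this
  have key := hasDerivAt_integral_of_dominated_loc_of_deriv_le (μ := C.μ) (𝕜 := ℝ)
    (F := fun t X => l2 φ (weyl (X : Phase ℝ n) (weyl (t • Y) ψ)))
    (F' := fun t X => Complex.I * l2 φ (weyl (X : Phase ℝ n) (weyl (t • Y) χ)))
    -- On the unit ball around s one has |t| ≤ |s| + 1. The exponent m, one more than the dimension
    -- of the plane, makes the bound integrable.
    (bound := fun X => K * (1 + (|s| + 1) * ‖Y‖) ^ m * ((1 + ‖X‖) ^ m)⁻¹)
    (x₀ := s) (s := Metric.ball s 1) (Metric.ball_mem_nhds s one_pos)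
    (Eventually.of_forall fun t => (C.integrable_integrand φ (weyl (t • Y) ψ)).aestronglyMeasurable)
    (C.integrable_integrand _ _)
    ((C.integrable_integrand φ (weyl (s • Y) χ)).const_mul Complex.I).aestronglyMeasurable
    (Eventually.of_forall fun X t ht => ?_)
    ((integrable_inv_one_add_norm_pow C.μ (Nat.lt_succ_self _)).const_mul _)
    (Eventually.of_forall fun X t _ => ?_)
  · refine key.2.congr_deriv ?_
    rw [integral_const_mul]
    rfl
  · rw [norm_mul, Complex.norm_I, one_mul, norm_l2_weyl_weyl]
    refine (hK _ _).trans ?_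
    have h1 : ‖t • Y‖ ≤ (|s| + 1) * ‖Y‖ := by
      rw [norm_smul, Real.norm_eq_abs]
      gcongr
      have h2 : |t - s| < 1 := by simpa [Real.dist_eq] using ht
      have := abs_sub_abs_le_abs_sub t s
      linarith
    rw [Submodule.coe_norm]
    gcongr
  · have := hasDerivAt_l2_weyl (weyl (-(X : Phase ℝ n)) φ) ψ Y t
    simpa only [← l2_weyl_right] using this

/-- Isotropy removes the phase in the Weyl relation, and invariance of the measure absorbs the
remaining shift. -/
theorem form_weyl_of_mem {X : Phase ℝ n} (hX : X ∈ C.plane) (φ ψ : Wave n) :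
    C.form φ (weyl X ψ) = C.form φ ψ := by
  rw [form, form, ← integral_add_right_eq_self
    (fun X' : C.plane => l2 φ (weyl (X' : Phase ℝ n) ψ)) ⟨X, hX⟩]
  congr 1
  funext X'
  rw [weyl_weyl, C.isotropic _ X'.2 _ hX]
  simp

/-- This is the infinitesimal form of `form_weyl_of_mem`: the derivative at 0 of a constant
function. -/
theorem form_Omega_of_mem {X : Phase ℝ n} (hX : X ∈ C.plane) (φ ψ : Wave n) :
    C.form φ (Omega (toComplex X) ψ) = 0 := by
  have h1 := C.hasDerivAt_form_weyl φ ψ X 0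
  have h2 : (fun t : ℝ => C.form φ (weyl (t • X) ψ)) = fun _ => C.form φ ψ :=
    funext fun t => C.form_weyl_of_mem (C.plane.smul_mem t hX) φ ψ
  rw [h2] at h1
  have := h1.unique (hasDerivAt_const 0 _)
  simpa [weyl_zero] using this

theorem cls_eq_of_form {ψ φ : Wave n} (h : ∀ χ, C.form χ ψ = C.form χ φ) : C.cls ψ = C.cls φ := by
  rw [cls_eq_cls_iff, sub_eq_add_neg, form_add_right, ← neg_one_smul ℂ φ, form_smul_right, h]
  ring

theorem inner_cls (ψ φ : Wave n) :
    inner ℂ (C.cls ψ : C.PhysSpace) (C.cls φ : C.PhysSpace) = C.form ψ φ := by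
  rw [UniformSpace.Completion.inner_coe]
  rfl

theorem norm_cls_sq (ψ : Wave n) : ‖(C.cls ψ : C.PhysSpace)‖ ^ 2 = (C.form ψ ψ).re := by
  rw [← inner_self_eq_norm_sq (𝕜 := ℂ) (C.cls ψ : C.PhysSpace), inner_cls]
  rfl

theorem norm_form_le (ψ φ : Wave n) :
    ‖C.form ψ φ‖ ≤ ‖(C.cls ψ : C.PhysSpace)‖ * ‖(C.cls φ : C.PhysSpace)‖ := by
  rw [← C.inner_cls]
  exact norm_inner_le_norm (𝕜 := ℂ) (C.cls ψ : C.PhysSpace) (C.cls φ : C.PhysSpace)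

theorem cls_add (ψ φ : Wave n) : C.cls (ψ + φ) = C.cls ψ + C.cls φ := rfl

theorem cls_smul (c : ℂ) (φ : Wave n) : C.cls (c • φ) = c • C.cls φ := rfl

/-- The class of a wave function in the physical Hilbert space, as a linear map. -/
noncomputable def physCls : Wave n →ₗ[ℂ] C.PhysSpace where
  toFun ψ := (C.cls ψ : C.PhysSpace)
  map_add' ψ φ := by rw [cls_add, UniformSpace.Completion.coe_add]
  map_smul' c φ := by rw [cls_smul, UniformSpace.Completion.coe_smul]; rfl

theorem dense_range_physCls : DenseRange C.physCls :=
  UniformSpace.Completion.denseRange_coe.comp SeparationQuotient.surjective_mk.denseRange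
    (UniformSpace.Completion.continuous_coe _)

end ConstraintPlane

end LinearConstraint
namespace LinearConstraint

/-! ### Moyal orthogonality relation on phase space -/

section Moyal

variable {n : ℕ}

/-- The wave function `ξ ↦ conj (g (ξ - q)) ψ(ξ)`. -/
noncomputable def windowed (g : Wave n) (q : EuclideanSpace ℝ (Fin n)) (ψ : Wave n) : Wave n :=
  SchwartzMap.smulLeftCLM ℂ (fun ξ => conj (g (ξ - q))) ψ

theorem windowed_apply (g : Wave n) (q : EuclideanSpace ℝ (Fin n)) (ψ : Wave n) (ξ) :
    windowed g q ψ ξ = conj (g (ξ - q)) * ψ ξ := by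
  have h : Function.HasTemperateGrowth (fun ξ => conj (g (ξ - q))) := by
    have h1 := (SchwartzMap.compSubConstCLM ℂ q g).hasTemperateGrowth
    exact (Complex.conjCLE : ℂ →L[ℝ] ℂ).hasTemperateGrowth.comp h1
  rw [windowed, SchwartzMap.smulLeftCLM_apply_apply h, smul_eq_mul]

open FourierTransform in
theorem l2_weyl_eq_fourier (g ψ : Wave n) (P Q : Fin n → ℝ) :
    l2 (weyl (P, Q) g) ψ = Complex.exp (Complex.I * ((1 / 2 * ∑ j, P j * Q j : ℝ) : ℂ)) *
      𝓕 (windowed g (WithLp.toLp 2 Q) ψ) ((2 * Real.pi)⁻¹ • WithLp.toLp 2 P) := by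
  rw [SchwartzMap.fourier_coe, Real.fourier_eq', ← integral_const_mul, l2]
  congr 1
  funext ξ
  rw [weyl_apply, map_mul, windowed_apply, smul_eq_mul, ← mul_assoc, ← mul_assoc]
  congr 2
  rw [weylPhase, ← Complex.exp_conj, ← Complex.exp_add]
  congr 1
  have h : inner ℝ ξ ((2 * Real.pi)⁻¹ • WithLp.toLp 2 P) = (2 * Real.pi)⁻¹ * ∑ j, P j * ξ j := by
    rw [real_inner_smul_right, PiLp.inner_apply]
    simp
  rw [h, map_mul, Complex.conj_I, Complex.conj_ofReal]
  have h2 : -2 * Real.pi * ((2 * Real.pi)⁻¹ * ∑ j, P j * ξ j) = - ∑ j, P j * ξ j := by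
    field_simp
  rw [h2]
  push_cast
  ring

open FourierTransform in
-- At fixed Q both factors are Fourier transforms in P of windowed functions, up to phases that
-- cancel, so this is Parseval; (2π)^n is the Jacobian of the rescaling of P by 1/(2π).
theorem integral_momentum (g φ ψ : Wave n) (Q : Fin n → ℝ) :
    ∫ P : Fin n → ℝ, l2 (weyl (P, Q) g) ψ * l2 φ (weyl (P, Q) g)
      = (2 * Real.pi) ^ n * ∫ ξ, (conj (φ ξ) * ψ ξ) *
        (g (ξ - WithLp.toLp 2 Q) * conj (g (ξ - WithLp.toLp 2 Q))) := by
  set q : EuclideanSpace ℝ (Fin n) := WithLp.toLp 2 Q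
  set u := windowed g q ψ
  set v := windowed g q φ
  have h1 : ∀ P : Fin n → ℝ, l2 (weyl (P, Q) g) ψ * l2 φ (weyl (P, Q) g)
      = (fun p => 𝓕 u ((2 * Real.pi)⁻¹ • p) * conj (𝓕 v ((2 * Real.pi)⁻¹ • p)))
        (WithLp.toLp 2 P) := by
    intro P
    rw [← l2_conj (weyl (P, Q) g) φ, l2_weyl_eq_fourier, l2_weyl_eq_fourier, map_mul]
    have : Complex.exp (Complex.I * ((1 / 2 * ∑ j, P j * Q j : ℝ) : ℂ)) *
        conj (Complex.exp (Complex.I * ((1 / 2 * ∑ j, P j * Q j : ℝ) : ℂ))) = 1 := by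
      rw [Complex.mul_conj, Complex.normSq_eq_norm_sq, mul_comm, Complex.norm_exp_ofReal_mul_I]
      simp
    linear_combination (𝓕 u ((2 * Real.pi)⁻¹ • WithLp.toLp 2 P) *
      conj (𝓕 v ((2 * Real.pi)⁻¹ • WithLp.toLp 2 P))) * this
  rw [funext h1, (PiLp.volume_preserving_toLp (Fin n)).integral_comp
    (MeasurableEquiv.toLp 2 (Fin n → ℝ)).measurableEmbedding
    (fun p => 𝓕 u ((2 * Real.pi)⁻¹ • p) * conj (𝓕 v ((2 * Real.pi)⁻¹ • p))),
    Measure.integral_comp_smul volume (fun p => 𝓕 u p * conj (𝓕 v p))]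
  have h2 := SchwartzMap.integral_inner_fourier_fourier v u
  simp only [RCLike.inner_apply] at h2
  rw [h2, finrank_euclideanSpace_fin, Complex.real_smul]
  congr 1
  · rw [inv_pow, inv_inv, abs_of_pos (by positivity)]
    push_cast
    rfl
  · congr 1
    funext ξ
    simp only [u, v, windowed_apply, map_mul, Complex.conj_conj]
    ring

instance isAddHaarMeasure_volume_phase : (volume : Measure (Phase ℝ n)).IsAddHaarMeasure :=
  Measure.prod.instIsAddHaarMeasure volume volume

theorem continuous_l2_weyl_left (g ψ : Wave n) :
    Continuous (fun Y : Phase ℝ n => l2 (weyl Y g) ψ) := by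
  simp only [← l2_conj ψ]
  exact Complex.continuous_conj.comp (continuous_l2_weyl ψ g)

theorem exists_norm_l2_weyl_left_le (m : ℕ) (g ψ : Wave n) :
    ∃ C, ∀ Y : Phase ℝ n, ‖l2 (weyl Y g) ψ‖ ≤ C * ((1 + ‖Y‖) ^ m)⁻¹ := by
  obtain ⟨C, hC⟩ := norm_l2_weyl_add_le m ψ g
  refine ⟨C, fun Y => ?_⟩
  rw [← l2_conj, RCLike.norm_conj]
  simpa using hC Y 0

theorem integrable_l2_weyl_left (g ψ : Wave n) :
    Integrable (fun Y : Phase ℝ n => l2 (weyl Y g) ψ) := by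
  obtain ⟨C, hC⟩ := exists_norm_l2_weyl_left_le (Module.finrank ℝ (Phase ℝ n) + 1) g ψ
  exact ((integrable_inv_one_add_norm_pow volume (Nat.lt_succ_self _)).const_mul C).mono'
    (continuous_l2_weyl_left g ψ).aestronglyMeasurable (Eventually.of_forall hC)

theorem integrable_l2_weyl_mul (g φ ψ : Wave n) :
    Integrable (fun Y : Phase ℝ n => l2 (weyl Y g) ψ * l2 φ (weyl Y g)) := by
  obtain ⟨C, hC⟩ := norm_l2_weyl_le φ g
  exact (integrable_l2_weyl_left g ψ).mul_bdd (c := C)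
    (continuous_l2_weyl φ g).aestronglyMeasurable (Eventually.of_forall hC)

theorem integral_l2_weyl_mul (g φ ψ : Wave n) :
    ∫ Y : Phase ℝ n, l2 (weyl Y g) ψ * l2 φ (weyl Y g)
      = (2 * Real.pi) ^ n * (l2 g g * l2 φ ψ) := by
  have h := integral_prod_symm (μ := (volume : Measure (Fin n → ℝ)))
    (ν := (volume : Measure (Fin n → ℝ))) _ (integrable_l2_weyl_mul g φ ψ)
  refine h.trans ?_
  simp only [integral_momentum]
  rw [integral_const_mul]
  congr 1
  rw [(PiLp.volume_preserving_toLp (Fin n)).integral_comp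
    (MeasurableEquiv.toLp 2 (Fin n → ℝ)).measurableEmbedding
    (fun q => ∫ ξ, (conj (φ ξ) * ψ ξ) * (g (ξ - q) * conj (g (ξ - q))))]
  -- As a function of q the inner integral is the convolution of conj(φ)ψ with the reflected |g|²,
  -- so its integral over q is the product of the two integrals.
  have hc := integral_convolution (μ := volume) (ν := volume) (ContinuousLinearMap.mul ℝ ℂ)
    (l2_integrable φ ψ) (l2_integrable g g).comp_neg
  simp only [convolution_def, ContinuousLinearMap.mul_apply'] at hc
  rw [integral_neg_eq_self (fun ξ => conj (g ξ) * g ξ)] at hc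
  rw [mul_comm]
  refine Eq.trans ?_ hc
  congr 1
  funext q
  congr 1
  funext ξ
  rw [neg_sub]
  ring

theorem l2_self_ne_zero {g : Wave n} (hg : g ≠ 0) : l2 g g ≠ 0 := by
  have h : l2 g g = ((∫ ξ, ‖g ξ‖ ^ 2 : ℝ) : ℂ) := by
    rw [l2, ← integral_complex_ofReal]
    congr 1
    funext ξ
    rw [← Complex.normSq_eq_conj_mul_self, Complex.normSq_eq_norm_sq]
  rw [h, Complex.ofReal_ne_zero]
  have hi : Integrable (fun ξ => ‖g ξ‖ ^ 2) := by
    refine (l2_integrable g g).norm.congr (Eventually.of_forall fun ξ => ?_)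
    simp [sq]
  intro h0
  rw [integral_eq_zero_iff_of_nonneg (fun ξ => by positivity) hi] at h0
  have h1 := (Continuous.ae_eq_iff_eq volume (by have := g.continuous; fun_prop)
    continuous_zero).1 h0
  refine hg (SchwartzMap.ext fun ξ => ?_)
  simpa using congrFun h1 ξ

end Moyal

/-! ### Totality of all Weyl translates in the physical space -/

namespace ConstraintPlane

variable {n k : ℕ} (C : ConstraintPlane n k)

/-- For Y outside the skew complement W(Y) need not preserve the form. Conjugating W(X) by W(Y)
still only multiplies it by a phase, so taking absolute values under the integral gives a bound
independent of Y. -/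
theorem exists_norm_cls_weyl_le (g : Wave n) :
    ∃ B, ∀ Y : Phase ℝ n, ‖(C.cls (weyl Y g) : C.PhysSpace)‖ ≤ B := by
  refine ⟨√(∫ X : C.plane, ‖l2 g (weyl (X : Phase ℝ n) g)‖ ∂C.μ), fun Y => Real.le_sqrt_of_sq_le ?_⟩
  rw [norm_cls_sq]
  refine (Complex.re_le_norm _).trans ((norm_integral_le_integral_norm _).trans (le_of_eq ?_))
  congr 1
  funext X
  rw [← l2_weyl_weyl (-Y), weyl_neg_weyl, norm_l2_weyl_weyl, norm_l2_weyl_weyl,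
    neg_add_cancel_comm]

/-- The orthogonality relation is applied with φ replaced by W(-X)φ and integrated over X in the
plane; Fubini then moves that integration inside. -/
theorem form_mul_eq_integral (g φ ψ : Wave n) :
    (2 * Real.pi) ^ n * (l2 g g * C.form φ ψ)
      = ∫ Y : Phase ℝ n, l2 (weyl Y g) ψ * C.form φ (weyl Y g) := by
  set m := Module.finrank ℝ C.plane + 1
  set m' := Module.finrank ℝ (Phase ℝ n) + 1
  obtain ⟨K, hK⟩ := norm_l2_weyl_add_le m φ g
  -- Of the decay in Y, m powers compensate the growth (1+‖Y‖)^m of the other factor, and m' powers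
  -- remain for integrability over phase space.
  obtain ⟨K', hK'⟩ := exists_norm_l2_weyl_left_le (m + m') g ψ
  have hint : Integrable (Function.uncurry fun (X : C.plane) (Y : Phase ℝ n) =>
      l2 (weyl Y g) ψ * l2 φ (weyl (X : Phase ℝ n) (weyl Y g))) (C.μ.prod volume) := by
    have h1 := (integrable_inv_one_add_norm_pow C.μ (m := m) (Nat.lt_succ_self _)).mul_prod
      (integrable_inv_one_add_norm_pow (volume : Measure (Phase ℝ n)) (m := m')
        (Nat.lt_succ_self _))
    refine (h1.const_mul (K * K')).mono' ?_ (Eventually.of_forall fun p => ?_)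
    · have h2 : Continuous fun p : C.plane × Phase ℝ n =>
          l2 (weyl p.2 g) ψ * (Complex.exp (Complex.I / 2 * (sympl (p.1 : Phase ℝ n) p.2 : ℝ)) *
            l2 φ (weyl ((p.1 : Phase ℝ n) + p.2) g)) := by
        have h3 := (continuous_l2_weyl_left g ψ).comp (continuous_snd (X := C.plane))
        have h4 := (continuous_l2_weyl φ g).comp
          (f := fun p : C.plane × Phase ℝ n => (p.1 : Phase ℝ n) + p.2) (by fun_prop)
        refine h3.mul (Continuous.mul ?_ h4)
        simp only [sympl]
        fun_prop
      refine h2.aestronglyMeasurable.congr (Eventually.of_forall fun p => ?_)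
      simp only [Function.uncurry_def, weyl_weyl, l2_smul_right]
    · obtain ⟨X, Y⟩ := p
      simp only [Function.uncurry_apply_pair, norm_mul, norm_l2_weyl_weyl]
      calc _ ≤ (K' * ((1 + ‖Y‖) ^ (m + m'))⁻¹) * (K * (1 + ‖Y‖) ^ m * ((1 + ‖X‖) ^ m)⁻¹) :=
            mul_le_mul (hK' Y) (hK X Y) (norm_nonneg _) ((norm_nonneg _).trans (hK' Y))
        _ = _ := by
          rw [pow_add]
          have : (1 + ‖Y‖) ^ m ≠ 0 := by positivity
          field_simp
  calc (2 * Real.pi) ^ n * (l2 g g * C.form φ ψ)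
      = ∫ X : C.plane, (∫ Y : Phase ℝ n,
          l2 (weyl Y g) ψ * l2 φ (weyl (X : Phase ℝ n) (weyl Y g))) ∂C.μ := by
        rw [form, ← integral_const_mul, ← integral_const_mul]
        congr 1
        funext X
        simp only [l2_weyl_right (X : Phase ℝ n) φ]
        exact (integral_l2_weyl_mul g _ ψ).symm
    _ = _ := by
        rw [integral_integral_swap hint]
        congr 1
        funext Y
        rw [integral_const_mul, form]

/-- The classes of all Weyl translates of a nonzero wave function span a dense subspace. -/
theorem eq_top_of_weyl_mem {g : Wave n} (hg : g ≠ 0) (K : Submodule ℂ C.PhysSpace)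
    (hK : IsClosed (K : Set C.PhysSpace))
    (h : ∀ Y : Phase ℝ n, (C.cls (weyl Y g) : C.PhysSpace) ∈ K) : K = ⊤ := by
  rw [← hK.submodule_topologicalClosure_eq, Submodule.topologicalClosure_eq_top_iff,
    Submodule.eq_bot_iff]
  intro v hv
  obtain ⟨B, hB⟩ := C.exists_norm_cls_weyl_le g
  have hN : (2 * Real.pi : ℂ) ^ n * l2 g g ≠ 0 :=
    mul_ne_zero (pow_ne_zero _ (by exact_mod_cast Real.two_pi_pos.ne')) (l2_self_ne_zero hg)
  -- The orthogonal vector v lies only in the completion, so the integral formula is used for wave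
  -- functions φ approximating it. Since v is orthogonal to every [W(Y)g], φ may be replaced by φ -
  -- v inside the integral, and the bound tends to 0 as φ tends to v.
  have hbound : ∀ φ ψ : Wave n, ‖(2 * Real.pi : ℂ) ^ n * l2 g g‖ * ‖C.form φ ψ‖
      ≤ ‖C.physCls φ - v‖ * (B * ∫ Y : Phase ℝ n, ‖l2 (weyl Y g) ψ‖) := by
    intro φ ψ
    rw [← norm_mul, mul_assoc, C.form_mul_eq_integral, ← mul_assoc, ← integral_const_mul]
    refine norm_integral_le_of_norm_le ((integrable_l2_weyl_left g ψ).norm.const_mul _)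
      (Eventually.of_forall fun Y => ?_)
    have h1 : C.form φ (weyl Y g) = inner ℂ (C.physCls φ - v) (C.cls (weyl Y g) : C.PhysSpace) := by
      rw [inner_sub_left, Submodule.inner_left_of_mem_orthogonal (h Y) hv, sub_zero]
      exact (C.inner_cls _ _).symm
    rw [norm_mul, mul_comm, h1]
    refine mul_le_mul_of_nonneg_right ?_ (norm_nonneg _)
    refine (norm_inner_le_norm (𝕜 := ℂ) (C.physCls φ - v)
      (C.cls (weyl Y g) : C.PhysSpace)).trans ?_
    gcongr
    exact hB Y
  obtain ⟨φ, hφ⟩ := mem_closure_iff_seq_limit.1 (C.dense_range_physCls v)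
  choose hφ1 hφ2 using hφ
  choose f hf using hφ1
  have hlim : Tendsto (fun j => C.physCls (f j)) atTop (𝓝 v) := by simpa only [hf] using hφ2
  have hzero : ∀ ψ : Wave n, inner ℂ v (C.physCls ψ) = 0 := by
    intro ψ
    have h1 : Tendsto (fun j => ‖(2 * Real.pi : ℂ) ^ n * l2 g g‖ * ‖C.form (f j) ψ‖) atTop
        (𝓝 (‖(2 * Real.pi : ℂ) ^ n * l2 g g‖ * ‖(inner ℂ v (C.physCls ψ) : ℂ)‖)) := by
      have h2 : ∀ j, C.form (f j) ψ = inner ℂ (C.physCls (f j)) (C.physCls ψ) := fun j =>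
        (C.inner_cls _ _).symm
      simp only [h2]
      exact ((hlim.inner tendsto_const_nhds).norm).const_mul _
    have h3 : Tendsto (fun j => ‖C.physCls (f j) - v‖ * (B * ∫ Y : Phase ℝ n, ‖l2 (weyl Y g) ψ‖))
        atTop (𝓝 0) := by
      simpa using (tendsto_iff_norm_sub_tendsto_zero.1 hlim).mul_const
        (B * ∫ Y : Phase ℝ n, ‖l2 (weyl Y g) ψ‖)
    have h4 := le_of_tendsto_of_tendsto' h1 h3 fun j => hbound (f j) ψ
    have h5 : ‖(inner ℂ v (C.physCls ψ) : ℂ)‖ ≤ 0 := by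
      by_contra! hc
      exact absurd h4 (not_le.2 (mul_pos (norm_pos_iff.2 hN) hc))
    exact norm_le_zero_iff.1 h5
  have h6 : (fun w => inner ℂ v w) = fun _ : C.PhysSpace => (0 : ℂ) :=
    C.dense_range_physCls.equalizer (by fun_prop) continuous_const (funext hzero)
  exact inner_self_eq_zero.1 (congrFun h6 v)

end ConstraintPlane

end LinearConstraint
namespace LinearConstraint

/-! ### The complex structure attached to the matrix of a Gaussian -/

section ComplexStructure

open Matrix

variable {n : ℕ}

theorem _root_.Matrix.IsSymm.mulVec_dotProduct {ι R : Type*} [Fintype ι] [CommSemiring R]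
    {M : Matrix ι ι R} (hM : M.IsSymm) (v w : ι → R) : (M *ᵥ v) ⬝ᵥ w = v ⬝ᵥ (M *ᵥ w) := by
  rw [dotProduct_comm, dotProduct_mulVec, ← mulVec_transpose, hM.eq, dotProduct_comm]

theorem sympl_eq_dotProduct (X Y : Phase ℝ n) : sympl X Y = X.1 ⬝ᵥ Y.2 - Y.1 ⬝ᵥ X.2 := by
  simp only [sympl, dotProduct, Finset.sum_sub_distrib]

/-- The complex structure on `ℝ^{2n}` determined by a Gaussian with matrix `A`. -/
noncomputable def complexStructure (A : Matrix (Fin n) (Fin n) ℂ) : Phase ℝ n →ₗ[ℝ] Phase ℝ n where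
  toFun X :=
    (A.map Complex.im *ᵥ X.2 -
        A.map Complex.re *ᵥ ((A.map Complex.im)⁻¹ *ᵥ (X.1 - A.map Complex.re *ᵥ X.2)),
      -((A.map Complex.im)⁻¹ *ᵥ (X.1 - A.map Complex.re *ᵥ X.2)))
  map_add' X Y := by
    ext j <;> simp only [Prod.fst_add, Prod.snd_add, mulVec_add, mulVec_sub, Pi.add_apply,
      Pi.sub_apply, Pi.neg_apply] <;> ring
  map_smul' c X := by
    ext j <;> simp only [Prod.smul_fst, Prod.smul_snd, mulVec_smul, mulVec_sub, Pi.smul_apply,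
      Pi.sub_apply, Pi.neg_apply, RingHom.id_apply, smul_eq_mul] <;> ring

variable {A : Matrix (Fin n) (Fin n) ℂ}

theorem sympl_complexStructure (hs : A.IsSymm) (X Y : Phase ℝ n) :
    sympl (complexStructure A X) Y = (A.map Complex.im *ᵥ X.2) ⬝ᵥ Y.2 +
      ((A.map Complex.im)⁻¹ *ᵥ (X.1 - A.map Complex.re *ᵥ X.2)) ⬝ᵥ
        (Y.1 - A.map Complex.re *ᵥ Y.2) := by
  rw [sympl_eq_dotProduct]
  simp only [complexStructure, LinearMap.coe_mk, AddHom.coe_mk]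
  rw [sub_dotProduct, (hs.map Complex.re).mulVec_dotProduct, dotProduct_neg, dotProduct_sub,
    dotProduct_comm Y.1]
  ring

/-- With A = R + iS and X = (P,Q), the value is Q·SQ + (P-RQ)·S⁻¹(P-RQ), and S and S⁻¹ are positive
definite. -/
theorem sympl_complexStructure_self_pos (hs : A.IsSymm) (hp : (A.map Complex.im).PosDef)
    {X : Phase ℝ n} (hX : X ≠ 0) : 0 < sympl (complexStructure A X) X := by
  rw [sympl_complexStructure hs, dotProduct_comm, dotProduct_comm (_ *ᵥ _)]
  have h1 := hp.posSemidef.dotProduct_mulVec_nonneg X.2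
  have h2 := hp.inv.posSemidef.dotProduct_mulVec_nonneg (X.1 - A.map Complex.re *ᵥ X.2)
  rw [star_trivial] at h1 h2
  by_cases hQ : X.2 = 0
  · have hP : X.1 - A.map Complex.re *ᵥ X.2 ≠ 0 := by
      rw [hQ, mulVec_zero, sub_zero]
      exact fun h => hX (Prod.ext h hQ)
    have h3 := hp.inv.dotProduct_mulVec_pos hP
    rw [star_trivial] at h3
    linarith
  · have h3 := hp.dotProduct_mulVec_pos hQ
    rw [star_trivial] at h3
    linarith

/-- This condition dictates the formula for J: with q the second component of JX, the imaginary part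
reads Sq = RQ - P and the real part gives the first component SQ + Rq. -/
theorem complexStructure_sub_I_smul (hp : (A.map Complex.im).PosDef) (X : Phase ℝ n) :
    (toComplex (complexStructure A X) - Complex.I • toComplex X).1
      = A *ᵥ (toComplex (complexStructure A X) - Complex.I • toComplex X).2 := by
  set q := -((A.map Complex.im)⁻¹ *ᵥ (X.1 - A.map Complex.re *ᵥ X.2)) with hq
  have h1 : A.map Complex.im *ᵥ q = A.map Complex.re *ᵥ X.2 - X.1 := by
    rw [hq, mulVec_neg, mulVec_mulVec, mul_nonsing_inv _ ((isUnit_iff_isUnit_det _).1 hp.isUnit),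
      one_mulVec, neg_sub]
  have h2 : complexStructure A X = (A.map Complex.im *ᵥ X.2 + A.map Complex.re *ᵥ q, q) := by
    rw [hq, mulVec_neg, ← sub_eq_add_neg]
    rfl
  rw [h2]
  funext j
  have h3 := congrFun h1 j
  simp only [mulVec, dotProduct, map_apply, Pi.sub_apply] at h3
  apply Complex.ext
  · simp [toComplex, mulVec, dotProduct, Finset.sum_add_distrib]
    ring
  · simp [toComplex, mulVec, dotProduct, Finset.sum_add_distrib]
    linarith

/-- The form `ω(jX, X')` represents every functional on a subspace. -/
theorem exists_mem_sympl_complexStructure_eq (hs : A.IsSymm) (hp : (A.map Complex.im).PosDef)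
    (L : Submodule ℝ (Phase ℝ n)) (ℓ : Module.Dual ℝ (Phase ℝ n)) :
    ∃ X ∈ L, ∀ X' ∈ L, sympl (complexStructure A X) X' = ℓ X' := by
  let T : L →ₗ[ℝ] Module.Dual ℝ L := LinearMap.mk₂ ℝ
    (fun X X' : L => sympl (complexStructure A (X : Phase ℝ n)) (X' : Phase ℝ n))
    (fun X Y Z => by simp [sympl_add_left]) (fun c X Y => by simp [sympl_smul_left])
    (fun X Y Z => by simp [sympl_add_right]) (fun c X Y => by simp [sympl_smul_right])
  -- Positivity on the diagonal makes the form nondegenerate on every subspace; equality of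
  -- dimensions with the dual then gives surjectivity.
  have hT : Function.Injective T := by
    rw [injective_iff_map_eq_zero]
    intro X hX
    by_contra h
    have h1 := sympl_complexStructure_self_pos hs hp (X := X) (by simpa using h)
    have h2 : sympl (complexStructure A (X : Phase ℝ n)) X = 0 := LinearMap.congr_fun hX X
    exact h1.ne' h2
  obtain ⟨X, hX⟩ := (LinearMap.injective_iff_surjective_of_finrank_eq_finrank
    Subspace.dual_finrank_eq.symm).1 hT (ℓ.comp L.subtype)
  exact ⟨X, X.2, fun X' hX' => LinearMap.congr_fun hX ⟨X', hX'⟩⟩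

end ComplexStructure

/-! ### Annihilators of a Gaussian and the first density statement -/

section Gaussian

open Matrix

variable {n : ℕ} {c : ℂ} {A : Matrix (Fin n) (Fin n) ℂ} {ψ : Wave n}

theorem IsGaussian.ne_zero (h : IsGaussian c A ψ) : ψ ≠ 0 := by
  intro h0
  have := h.2.2.2 0
  rw [h0] at this
  simp at this
  exact h.1 this.symm

theorem IsGaussian.fderiv_single (h : IsGaussian c A ψ) (ξ : EuclideanSpace ℝ (Fin n))
    (i : Fin n) : fderiv ℝ ψ ξ (EuclideanSpace.single i (1 : ℝ))
      = Complex.I * (∑ l, A i l * (ξ l : ℂ)) * ψ ξ := by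
  set v := EuclideanSpace.single i (1 : ℝ) with hv
  have hl : HasDerivAt (fun t : ℝ => ξ + t • v) v 0 := by
    simpa using ((hasDerivAt_id (0 : ℝ)).smul_const v).const_add ξ
  have h1 : HasDerivAt (fun t : ℝ => ψ (ξ + t • v)) (fderiv ℝ ψ ξ v) 0 := by
    have := (ψ.hasFDerivAt (ξ + (0 : ℝ) • v)).comp_hasDerivAt 0 hl
    simpa [Function.comp_def] using this
  have hcoord : ∀ j, HasDerivAt (fun t : ℝ => (((ξ + t • v) j : ℝ) : ℂ)) ((v j : ℝ) : ℂ) 0 := by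
    intro j
    have := ((hasDerivAt_id (0 : ℝ)).mul_const (v j)).const_add (ξ j)
    simpa using this.ofReal_comp
  have h2 : HasDerivAt (fun t : ℝ => c * Complex.exp (Complex.I / 2 *
      ∑ j, ∑ l, (((ξ + t • v) j : ℝ) : ℂ) * A j l * (((ξ + t • v) l : ℝ) : ℂ))) _ 0 :=
    ((HasDerivAt.fun_sum fun j _ => HasDerivAt.fun_sum fun l _ =>
      ((hcoord j).mul_const (A j l)).fun_mul (hcoord l)).const_mul (Complex.I / 2)).cexp.const_mul c
  have h3 : (fun t : ℝ => ψ (ξ + t • v)) = _ := funext fun t => h.2.2.2 (ξ + t • v)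
  rw [h3] at h1
  rw [h1.unique h2, h.2.2.2 ξ]
  have h4 : ∑ j, ∑ l, (((v j : ℝ) : ℂ) * A j l * ((ξ l : ℝ) : ℂ) + (ξ j : ℂ) * A j l * (v l : ℂ))
      = 2 * ∑ l, A i l * (ξ l : ℂ) := by
    have e1 : ∑ j, ∑ l, ((v j : ℝ) : ℂ) * A j l * ((ξ l : ℝ) : ℂ) = ∑ l, A i l * (ξ l : ℂ) := by
      rw [Finset.sum_eq_single i]
      · simp [hv]
      · intro j _ hj
        simp [hv, hj]
      · simp
    have e2 : ∑ j, ∑ l, (ξ j : ℂ) * A j l * (v l : ℂ) = ∑ l, A i l * (ξ l : ℂ) := by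
      refine Finset.sum_congr rfl fun j _ => ?_
      rw [Finset.sum_eq_single i]
      · simp [hv, h.2.1.apply i j, mul_comm]
      · intro l _ hl
        simp [hv, hl]
      · simp
    simp only [Finset.sum_add_distrib]
    rw [e1, e2, two_mul]
  simp only [zero_smul, add_zero]
  rw [h4]
  ring

/-- The logarithmic gradient of the Gaussian is iAξ, so Ω(P,Q) multiplies it by (P - AQ)·ξ. -/
theorem IsGaussian.Omega_eq_zero (h : IsGaussian c A ψ) {Y : Phase ℂ n} (hY : Y.1 = A *ᵥ Y.2) :
    Omega Y ψ = 0 := by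
  ext ξ
  have h1 : ∑ j, Y.1 j * (ξ j : ℂ) = ∑ j, Y.2 j * ∑ l, A j l * (ξ l : ℂ) := by
    have := h.2.1.mulVec_dotProduct Y.2 (fun j => (ξ j : ℂ))
    rw [← hY] at this
    simpa [dotProduct, mulVec] using this
  rw [Omega_apply]
  simp only [h.fderiv_single]
  calc _ = (∑ j, Y.1 j * (ξ j : ℂ) + Complex.I * Complex.I *
        ∑ j, Y.2 j * ∑ l, A j l * (ξ l : ℂ)) * ψ ξ := by
        rw [add_mul, Finset.sum_mul, Finset.mul_sum, Finset.sum_mul, ← Finset.sum_add_distrib]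
        exact Finset.sum_congr rfl fun j _ => by ring
    _ = 0 := by rw [h1, Complex.I_mul_I]; ring

theorem Omega_add (Y Z : Phase ℂ n) : Omega (Y + Z) = Omega Y + Omega Z := by
  simp only [Omega, ← Finset.sum_add_distrib]
  refine Finset.sum_congr rfl fun j _ => ?_
  simp only [Prod.fst_add, Prod.snd_add, Pi.add_apply, add_smul]
  abel

theorem Omega_smul (a : ℂ) (Y : Phase ℂ n) : Omega (a • Y) = a • Omega Y := by
  simp only [Omega, Finset.smul_sum]
  refine Finset.sum_congr rfl fun j _ => ?_
  simp only [Prod.smul_fst, Prod.smul_snd, Pi.smul_apply, smul_eq_mul, mul_smul, smul_sub]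

theorem IsGaussian.Omega_complexStructure (h : IsGaussian c A ψ) (X : Phase ℝ n) :
    Omega (toComplex (complexStructure A X)) ψ = Complex.I • Omega (toComplex X) ψ := by
  have h1 := h.Omega_eq_zero (complexStructure_sub_I_smul h.2.2.1 X)
  rw [sub_eq_add_neg, ← neg_smul, Omega_add, Omega_smul] at h1
  rw [_root_.add_apply, _root_.smul_apply, neg_smul, add_neg_eq_zero] at h1
  exact h1

end Gaussian

theorem eq_exp_mul_of_hasDerivAt {f : ℝ → ℂ} {a b : ℂ}
    (hf : ∀ s : ℝ, HasDerivAt f ((s * a + b) * f s) s) : f 1 = Complex.exp (a / 2 + b) * f 0 := by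
  have h1 : ∀ s : ℝ, HasDerivAt (fun t : ℝ => Complex.exp (-((t : ℂ) ^ 2 * (a / 2) + t * b)) * f t)
      0 s := by
    intro s
    have h2 : HasDerivAt (fun t : ℝ => (t : ℂ)) 1 s := Complex.ofRealCLM.hasDerivAt
    have h3 := (((h2.pow 2).mul_const (a / 2)).add (h2.mul_const b)).neg.cexp.mul (hf s)
    refine h3.congr_deriv ?_
    simp
    ring
  have h4 := is_const_of_deriv_eq_zero (fun s => (h1 s).differentiableAt)
    (fun s => (h1 s).deriv) 1 0
  simp only [Complex.ofReal_one, Complex.ofReal_zero, one_pow, one_mul, ne_eq, OfNat.ofNat_ne_zero,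
    not_false_eq_true, zero_pow, zero_mul, add_zero, neg_zero, Complex.exp_zero] at h4
  rw [← h4, ← mul_assoc, ← Complex.exp_add]
  simp

namespace ConstraintPlane

variable {n k : ℕ} (C : ConstraintPlane n k) {c : ℂ} {A : Matrix (Fin n) (Fin n) ℂ} {ψ : Wave n}

/-- Along s ↦ W(sJX), the generator acts on W(Y)ψ as iΩ(X) plus a scalar. Moving Ω(X) to the left of
W(sJX) costs the scalar sω(X,JX), after which the form kills it. Each pairing with φ thus solves the
same scalar linear equation, so its values at 1 and 0 have a ratio independent of φ. -/
theorem cls_weyl_complexStructure (h : IsGaussian c A ψ) {X Y : Phase ℝ n} (hX : X ∈ C.plane)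
    (hY : Y ∈ C.skewPerp) :
    ∃ κ : ℂ, C.cls (weyl (complexStructure A X) (weyl Y ψ)) = κ • C.cls (weyl Y ψ) := by
  set V := complexStructure A X
  have hΩ : Omega (toComplex V) (weyl Y ψ)
      = Complex.I • Omega (toComplex X) (weyl Y ψ) + ((sympl V Y : ℝ) : ℂ) • weyl Y ψ := by
    have hXY : sympl X Y = 0 := by rw [sympl_comm, hY X hX, neg_zero]
    rw [Omega_weyl, h.Omega_complexStructure, Omega_weyl, sympl_toComplex, sympl_toComplex, hXY,
      map_smul]
    simp
  have hd : ∀ φ : Wave n, ∀ s : ℝ, HasDerivAt (fun t : ℝ => C.form φ (weyl (t • V) (weyl Y ψ)))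
      ((s * ((sympl X V : ℝ) : ℂ) + Complex.I * ((sympl V Y : ℝ) : ℂ)) *
        C.form φ (weyl (s • V) (weyl Y ψ))) s := by
    intro φ s
    refine (C.hasDerivAt_form_weyl φ (weyl Y ψ) V s).congr_deriv ?_
    have hc := C.form_Omega_of_mem hX φ (weyl (s • V) (weyl Y ψ))
    rw [Omega_weyl, sympl_toComplex, sympl_smul_right, form_add_right, form_smul_right] at hc
    rw [hΩ, map_add, map_smul, map_smul, form_add_right, form_smul_right, form_smul_right]
    push_cast at hc ⊢
    linear_combination (-1 : ℂ) * hc +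
      (C.form φ (weyl (s • V) (Omega (toComplex X) (weyl Y ψ)))) * Complex.I_mul_I
  refine ⟨Complex.exp (((sympl X V : ℝ) : ℂ) / 2 + Complex.I * ((sympl V Y : ℝ) : ℂ)), ?_⟩
  rw [← cls_smul]
  refine C.cls_eq_of_form fun φ => ?_
  have := eq_exp_mul_of_hasDerivAt (hd φ)
  rw [one_smul, zero_smul, weyl_zero] at this
  rw [this, form_smul_right]

theorem dense_span_weyl (h : IsGaussian c A ψ) :
    Dense (Submodule.span ℂ {v : C.PhysSpace | ∃ Y : C.skewPerp,
      v = C.weylPhys Y (C.cls ψ : C.PhysSpace)} : Set C.PhysSpace) := by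
  rw [Submodule.dense_iff_topologicalClosure_eq_top]
  refine C.eq_top_of_weyl_mem h.ne_zero _ (Submodule.isClosed_topologicalClosure _) fun Y => ?_
  refine Submodule.le_topologicalClosure _ ?_
  -- X is chosen so that JX and Y have the same pairing with the plane; their difference then lies
  -- in the skew complement.
  obtain ⟨X, hX, hXY⟩ := exists_mem_sympl_complexStructure_eq h.2.1 h.2.2.1 C.plane
    { toFun := fun X' => sympl Y X'
      map_add' := fun _ _ => sympl_add_right _ _ _
      map_smul' := fun _ _ => sympl_smul_right _ _ _ }
  have hY0 : Y - complexStructure A X ∈ C.skewPerp := by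
    intro X' hX'
    have := hXY X' hX'
    simp only [LinearMap.coe_mk, AddHom.coe_mk] at this
    rw [sub_eq_add_neg, sympl_add_left, sympl_comm (-_), sympl_neg_right,
      sympl_comm X' (complexStructure A X), this]
    ring
  obtain ⟨κ, hκ⟩ := C.cls_weyl_complexStructure h hX hY0
  rw [weyl_weyl, add_sub_cancel, cls_smul] at hκ
  have h1 : C.cls (weyl Y ψ) = (Complex.exp (Complex.I / 2 *
      (sympl (complexStructure A X) (Y - complexStructure A X) : ℝ)))⁻¹ •
        κ • C.cls (weyl (Y - complexStructure A X) ψ) := by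
    rw [← hκ, inv_smul_smul₀ (Complex.exp_ne_zero _)]
  rw [h1, UniformSpace.Completion.coe_smul, UniformSpace.Completion.coe_smul]
  refine Submodule.smul_mem _ _ (Submodule.smul_mem _ _ (Submodule.subset_span ⟨⟨_, hY0⟩, ?_⟩))
  rw [weylPhys_cls]

end ConstraintPlane

end LinearConstraint
namespace LinearConstraint

/-! ### Commutation relations and normal ordering -/

section Commutator

variable {M : Type*} [AddCommGroup M] [Module ℂ M]

theorem annihilation_iterate {a x : M →ₗ[ℂ] M} {κ : ℂ} {ψ : M}
    (hax : ∀ φ, a (x φ) = x (a φ) + κ • φ) (ha : a ψ = 0) (m : ℕ) :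
    a (x^[m + 1] ψ) = ((m + 1 : ℕ) * κ) • x^[m] ψ := by
  induction m with
  | zero => simp [hax, ha]
  | succ m ih =>
    rw [Function.iterate_succ_apply', hax, ih, map_smul, ← Function.iterate_succ_apply' x, ← add_smul]
    congr 1
    push_cast
    ring

/-- Here x - a plays the creation operator. It has the same commutator κ with a as x does, so the
span of its powers on ψ is stable under both x - a and a, hence under their sum x. -/
theorem iterate_mem_span_iterate_sub {a x : M →ₗ[ℂ] M} {κ : ℂ} {ψ : M}
    (hax : ∀ φ, a (x φ) = x (a φ) + κ • φ) (ha : a ψ = 0) (m : ℕ) :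
    x^[m] ψ ∈ Submodule.span ℂ (Set.range fun p : ℕ => (x - a)^[p] ψ) := by
  set S := Submodule.span ℂ (Set.range fun p : ℕ => (x - a)^[p] ψ)
  have had : ∀ φ, a ((x - a) φ) = (x - a) (a φ) + κ • φ := fun φ => by
    simp only [LinearMap.sub_apply, map_sub, hax]
    abel
  have h1 : S ≤ S.comap (x - a) := by
    rw [Submodule.span_le]
    rintro _ ⟨p, rfl⟩
    refine Submodule.subset_span ⟨p + 1, ?_⟩
    exact Function.iterate_succ_apply' _ _ _
  have h2 : S ≤ S.comap a := by
    rw [Submodule.span_le]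
    rintro _ ⟨p, rfl⟩
    rcases p with _ | p
    · simp [ha]
    · change a ((x - a)^[p + 1] ψ) ∈ S
      rw [annihilation_iterate had ha]
      exact S.smul_mem _ (Submodule.subset_span ⟨p, rfl⟩)
  induction m with
  | zero => exact Submodule.subset_span ⟨0, rfl⟩
  | succ m ih =>
    rw [Function.iterate_succ_apply']
    have := S.add_mem (h1 ih) (h2 ih)
    simpa using this

variable {n : ℕ}

/-- The commutator comes from differentiating `Omega_weyl` weakly along W(tY) at t = 0; testing the
resulting identity on the defect D itself shows D = 0. -/
theorem Omega_comm (Z : Phase ℂ n) (Y : Phase ℝ n) (ψ : Wave n) :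
    Omega Z (Omega (toComplex Y) ψ)
      = Omega (toComplex Y) (Omega Z ψ) + (-Complex.I * sympl Z (toComplex Y)) • ψ := by
  set D := Omega Z (Omega (toComplex Y) ψ) - (Omega (toComplex Y) (Omega Z ψ) +
    (-Complex.I * sympl Z (toComplex Y)) • ψ) with hD
  have key : ∀ φ : Wave n, Complex.I * l2 φ (Omega Z (Omega (toComplex Y) ψ))
      = Complex.I * l2 φ (Omega (toComplex Y) (Omega Z ψ)) +
        sympl Z (toComplex Y) * l2 φ ψ := by
    intro φ
    have h1 := hasDerivAt_l2_weyl (Omega (star Z) φ) ψ Y 0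
    have h2 := hasDerivAt_l2_weyl φ (Omega Z ψ) Y 0
    have h3 := ((hasDerivAt_id (0 : ℝ)).ofReal_comp.mul_const (sympl Z (toComplex Y))).mul
      (hasDerivAt_l2_weyl φ ψ Y 0)
    have h4 : (fun t : ℝ => l2 (Omega (star Z) φ) (weyl (t • Y) ψ)) = fun t : ℝ =>
        l2 φ (weyl (t • Y) (Omega Z ψ)) +
          ((id t : ℝ) : ℂ) * sympl Z (toComplex Y) * l2 φ (weyl (t • Y) ψ) := by
      funext t
      have h5 : sympl Z (toComplex (t • Y)) = t * sympl Z (toComplex Y) := by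
        simp only [sympl, Finset.mul_sum]
        exact Finset.sum_congr rfl fun j _ => by simp [toComplex]; ring
      rw [← l2_Omega_right, Omega_weyl, l2_add_right, l2_smul_right, h5]
      rfl
    rw [h4] at h1
    have h6 := h1.unique (h2.add h3)
    simp only [zero_smul, weyl_zero, id, Complex.ofReal_zero, zero_mul, add_zero,
      Complex.ofReal_one, one_mul, ← l2_Omega_right Z] at h6
    exact h6
  have hl : l2 D D = 0 := by
    have h1 := key D
    have h2 : l2 D D = l2 D (Omega Z (Omega (toComplex Y) ψ)) -
        (l2 D (Omega (toComplex Y) (Omega Z ψ)) +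
          (-Complex.I * sympl Z (toComplex Y)) * l2 D ψ) := by
      have h3 : ∀ φ χ : Wave n, l2 D (φ - χ) = l2 D φ - l2 D χ := fun φ χ => by
        rw [sub_eq_add_neg, ← neg_one_smul ℂ χ, l2_add_right, l2_smul_right]
        ring
      rw [← l2_smul_right, ← l2_add_right, ← h3]
    rw [h2]
    linear_combination (-Complex.I) * h1 +
      (l2 D (Omega Z (Omega (toComplex Y) ψ)) - l2 D (Omega (toComplex Y) (Omega Z ψ))) *
        Complex.I_mul_I
  by_contra hne
  exact l2_self_ne_zero (sub_ne_zero.2 hne) hl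

end Commutator

/-- Taylor's theorem for a sequence of successive derivatives. -/
theorem norm_sub_taylor_le {f : ℕ → ℝ → ℂ} (hf : ∀ m s, HasDerivAt (f m) (f (m + 1) s) s)
    (M : ℕ) {K : ℝ} (hK : ∀ s, ‖f (M + 1) s‖ ≤ K) :
    ‖f 0 1 - ∑ m ∈ Finset.range (M + 1), ((m.factorial : ℂ))⁻¹ * f m 0‖ ≤ K / M.factorial := by
  -- The base point of the Taylor polynomial varies while the evaluation point stays 1, so the
  -- derivative telescopes to one term. At t = 1 the polynomial equals f 0 1; at t = 0 it is the
  -- Taylor sum. The mean value inequality yields the denominator M!, not (M+1)!.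
  have hr : ∀ N : ℕ, ∀ s : ℝ, HasDerivAt (fun t : ℝ => ∑ m ∈ Finset.range (N + 1),
      (1 - (t : ℂ)) ^ m * (((m.factorial : ℂ))⁻¹ * f m t))
      ((1 - (s : ℂ)) ^ N * (((N.factorial : ℂ))⁻¹ * f (N + 1) s)) s := by
    intro N
    induction N with
    | zero => intro s; simpa using hf 0 s
    | succ N ih =>
      intro s
      simp only [Finset.sum_range_succ _ (N + 1)]
      have h1 : HasDerivAt (fun t : ℝ => 1 - (t : ℂ)) (-1) s :=
        (Complex.ofRealCLM.hasDerivAt (x := s)).const_sub 1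
      refine ((ih s).add ((h1.pow (N + 1)).mul
        ((hf (N + 1) s).const_mul ((((N + 1).factorial : ℕ) : ℂ))⁻¹))).congr_deriv ?_
      rw [Nat.factorial_succ]
      have h2 : (N.factorial : ℂ) ≠ 0 := by exact_mod_cast N.factorial_ne_zero
      have h3 : (N : ℂ) + 1 ≠ 0 := by exact_mod_cast N.succ_ne_zero
      push_cast
      simp only [Pi.pow_apply]
      field_simp
      ring
  have hmv := norm_image_sub_le_of_norm_deriv_le_segment_01'
    (fun s _ => (hr M s).hasDerivWithinAt) (C := K / M.factorial) fun s hs => ?_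
  · refine le_trans (le_of_eq ?_) hmv
    congr 2
    · rw [Finset.sum_range_succ']
      simp
    · simp
  · rw [norm_mul, norm_mul, norm_pow, norm_inv, Complex.norm_natCast, div_eq_inv_mul]
    have h1 : ‖(1 - (s : ℂ))‖ ≤ 1 := by
      rw [← Complex.ofReal_one, ← Complex.ofReal_sub, Complex.norm_real, Real.norm_eq_abs, abs_le]
      constructor <;> linarith [hs.1, hs.2]
    refine (mul_le_of_le_one_left (by positivity) (pow_le_one₀ (norm_nonneg _) h1)).trans ?_
    gcongr
    exact hK s

/-! ### Convergence of the exponential series and the second density statement -/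

namespace ConstraintPlane

variable {n k : ℕ} (C : ConstraintPlane n k) {c : ℂ} {A : Matrix (Fin n) (Fin n) ℂ} {ψ : Wave n}

theorem smul_mem_skewPerp {Y : Phase ℝ n} (hY : Y ∈ C.skewPerp) (s : ℝ) : s • Y ∈ C.skewPerp :=
  fun X hX => by rw [sympl_smul_left, hY X hX, mul_zero]

theorem norm_cls_weyl {Y : Phase ℝ n} (hY : Y ∈ C.skewPerp) (φ : Wave n) :
    ‖C.physCls (weyl Y φ)‖ = ‖C.physCls φ‖ := by
  refine (sq_eq_sq₀ (norm_nonneg _) (norm_nonneg _)).1 ?_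
  exact (C.norm_cls_sq _).trans ((congrArg Complex.re (C.form_weyl_weyl hY φ φ)).trans
    (C.norm_cls_sq _).symm)

/-- Truncations of the exponential series approximate `e^{iΩ(Y)}`. -/
theorem norm_weyl_sub_sum_le {Y : Phase ℝ n} (hY : Y ∈ C.skewPerp) (ψ : Wave n) (M : ℕ) :
    ‖C.physCls (weyl Y ψ - ∑ m ∈ Finset.range (M + 1),
      ((m.factorial : ℂ)⁻¹ * Complex.I ^ m) • (Omega (toComplex Y))^[m] ψ)‖
      ≤ ‖C.physCls ((Omega (toComplex Y))^[M + 1] ψ)‖ / M.factorial := by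
  set x := Omega (toComplex Y)
  set S := ∑ m ∈ Finset.range (M + 1), ((m.factorial : ℂ)⁻¹ * Complex.I ^ m) • x^[m] ψ with hS
  set D := weyl Y ψ - S with hD
  have hbound : ∀ s : ℝ, ‖Complex.I ^ (M + 1) * C.form D (weyl (s • Y) (x^[M + 1] ψ))‖
      ≤ ‖C.physCls D‖ * ‖C.physCls (x^[M + 1] ψ)‖ := by
    intro s
    rw [norm_mul, norm_pow, Complex.norm_I, one_pow, one_mul,
      ← C.norm_cls_weyl (C.smul_mem_skewPerp hY s) (x^[M + 1] ψ)]
    exact C.norm_form_le _ _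
  -- The scalar Taylor estimate is tested on the remainder D itself: it bounds ‖D‖² by ‖D‖ times the
  -- claimed bound, and one factor ‖D‖ cancels.
  have hT := norm_sub_taylor_le
    (f := fun m s => Complex.I ^ m * C.form D (weyl (s • Y) (x^[m] ψ))) (fun m s => by
      refine ((C.hasDerivAt_form_weyl D (x^[m] ψ) Y s).const_mul (Complex.I ^ m)).congr_deriv ?_
      rw [Function.iterate_succ_apply']
      ring) M hbound
  have hDD : C.form D D = Complex.I ^ 0 * C.form D (weyl ((1 : ℝ) • Y) (x^[0] ψ)) -
      ∑ m ∈ Finset.range (M + 1), ((m.factorial : ℂ))⁻¹ *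
        (Complex.I ^ m * C.form D (weyl ((0 : ℝ) • Y) (x^[m] ψ))) := by
    have h1 : ∀ φ, C.form D φ = inner ℂ (C.physCls D) (C.physCls φ) := fun φ =>
      (C.inner_cls _ _).symm
    simp only [h1, one_smul, zero_smul, weyl_zero, Function.iterate_zero, id, pow_zero, one_mul]
    have h2 : C.physCls D = C.physCls (weyl Y ψ) - ∑ m ∈ Finset.range (M + 1),
        ((m.factorial : ℂ)⁻¹ * Complex.I ^ m) • C.physCls (x^[m] ψ) := by
      simp only [hD, hS, map_sub, map_sum, map_smul]
    nth_rewrite 2 [h2]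
    simp only [inner_sub_right, inner_sum]
    congr 1
    refine Finset.sum_congr rfl fun m _ => ?_
    rw [← mul_assoc]
    exact inner_smul_right (C.physCls D) (C.physCls (x^[m] ψ)) _
  rw [← hDD] at hT
  have hsq : ‖C.physCls D‖ ^ 2 ≤ ‖C.form D D‖ :=
    (C.norm_cls_sq D).le.trans (Complex.re_le_norm _)
  have h2 := hsq.trans hT
  by_contra! hlt
  have hpos : 0 < ‖C.physCls D‖ := lt_of_le_of_lt (by positivity) hlt
  rw [sq, mul_div_assoc] at h2
  exact absurd (le_of_mul_le_mul_left h2 hpos) (not_le.2 hlt)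

theorem mem_skewPerpC_iff (Y : Phase ℂ n) :
    Y ∈ C.skewPerpC ↔ ∀ X ∈ C.plane, sympl Y (toComplex X) = 0 := by
  refine ⟨fun h X hX => h _ (Submodule.subset_span ⟨X, hX, rfl⟩), fun h X hX => ?_⟩
  induction hX using Submodule.span_induction with
  | mem X hX => obtain ⟨X, hX, rfl⟩ := hX; exact h X hX
  | zero => simp [sympl]
  | add X X' _ _ h1 h2 =>
    have : sympl Y (X + X') = sympl Y X + sympl Y X' := by
      simp only [sympl, ← Finset.sum_add_distrib]
      exact Finset.sum_congr rfl fun j _ => by simp; ring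
    rw [this, h1, h2, add_zero]
  | smul a X _ h1 =>
    have : sympl Y (a • X) = a * sympl Y X := by
      simp only [sympl, Finset.mul_sum]
      exact Finset.sum_congr rfl fun j _ => by simp; ring
    rw [this, h1, mul_zero]

theorem toComplex_mem_skewPerpC {Y : Phase ℝ n} (hY : Y ∈ C.skewPerp) :
    toComplex Y ∈ C.skewPerpC :=
  (C.mem_skewPerpC_iff _).2 fun X hX => by rw [sympl_toComplex, hY X hX, Complex.ofReal_zero]

theorem star_toComplex (Y : Phase ℝ n) : star (toComplex Y) = toComplex Y := by
  ext j <;> simp [toComplex]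

/-- The norms of the powers of `Ω(Y)` on a vector killed by an annihilation operator `Ω(Z)` with
`Ω(Y) = Ω(Z) + Ω(Z*)`. -/
theorem norm_iterate_Omega_sq_le {Y : Phase ℝ n} (hY : Y ∈ C.skewPerp) {Z : Phase ℂ n}
    (hZ : Z ∈ C.skewPerpC) (hYZ : toComplex Y = Z + star Z) (hψ : Omega Z ψ = 0) (M : ℕ) :
    ‖C.physCls ((Omega (toComplex Y))^[M] ψ)‖ ^ 2
      ≤ (2 * ‖sympl Z (toComplex Y)‖) ^ M * M.factorial * ‖C.form ψ ψ‖ := by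
  set x := Omega (toComplex Y)
  set κ := -Complex.I * sympl Z (toComplex Y) with hκ
  -- Split the outermost x as Ω(Z) + Ω(Z*): the second term moves to the left argument as Ω(Z)ψ = 0,
  -- while the first lowers the power by the commutator. This is the recursion of Gaussian moments.
  have hrec : ∀ m, C.form ψ (x^[m + 2] ψ) = ((m + 1 : ℕ) * κ) * C.form ψ (x^[m] ψ) := by
    intro m
    have h1 : x (x^[m + 1] ψ) = Omega Z (x^[m + 1] ψ) + Omega (star Z) (x^[m + 1] ψ) := by
      rw [← _root_.add_apply, ← Omega_add, ← hYZ]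
    have h2 := annihilation_iterate (a := (Omega Z : Wave n →ₗ[ℂ] Wave n))
      (x := (x : Wave n →ₗ[ℂ] Wave n)) (κ := κ) (ψ := ψ) (fun φ => Omega_comm Z Y φ) hψ m
    have h3 : C.form (0 : Wave n) (x^[m + 1] ψ) = 0 := by
      rw [← zero_smul ℂ ψ, form_smul_left, map_zero, zero_mul]
    rw [Function.iterate_succ_apply', h1, form_add_right, C.form_Omega (C.star_mem_skewPerpC hZ),
      star_star, hψ, h3, add_zero, ← form_smul_right]
    exact congrArg (C.form ψ) h2
  have hbound : ∀ m, ‖C.form ψ (x^[2 * m] ψ)‖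
      ≤ (2 * ‖sympl Z (toComplex Y)‖) ^ m * m.factorial * ‖C.form ψ ψ‖ := by
    intro m
    induction m with
    | zero => simp
    | succ m ih =>
      rw [mul_add, mul_one, hrec, norm_mul, norm_mul, hκ, norm_mul, norm_neg, Complex.norm_I, one_mul,
        Complex.norm_natCast, Nat.factorial_succ]
      -- The odd factor 2m+1 is enlarged to 2(m+1), so the double factorial is replaced by 2^m m!.
      calc _ ≤ ((2 * m + 1 : ℕ) * ‖sympl Z (toComplex Y)‖) *
            ((2 * ‖sympl Z (toComplex Y)‖) ^ m * m.factorial * ‖C.form ψ ψ‖) := by gcongr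
        _ ≤ ((2 * (m + 1) : ℕ) * ‖sympl Z (toComplex Y)‖) *
            ((2 * ‖sympl Z (toComplex Y)‖) ^ m * m.factorial * ‖C.form ψ ψ‖) := by
          gcongr
          omega
        _ = _ := by push_cast; ring
  have hsymm : ∀ m, ∀ φ : Wave n, C.form (x^[m] ψ) φ = C.form ψ (x^[m] φ) := by
    intro m
    induction m with
    | zero => intro φ; rfl
    | succ m ih =>
      intro φ
      have h1 := C.form_Omega (C.toComplex_mem_skewPerpC hY) (x^[m] ψ) φ
      rw [star_toComplex] at h1
      rw [Function.iterate_succ_apply', ← h1, ih, ← Function.iterate_succ_apply]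
  refine (C.norm_cls_sq _).le.trans ((Complex.re_le_norm _).trans ?_)
  rw [hsymm, ← Function.iterate_add_apply, ← two_mul]
  exact hbound M

theorem tendsto_sum_iterate_Omega {Y : Phase ℝ n} (hY : Y ∈ C.skewPerp) {Z : Phase ℂ n}
    (hZ : Z ∈ C.skewPerpC) (hYZ : toComplex Y = Z + star Z) (hψ : Omega Z ψ = 0) :
    Tendsto (fun M : ℕ => C.physCls (∑ m ∈ Finset.range (M + 1),
      ((m.factorial : ℂ)⁻¹ * Complex.I ^ m) • (Omega (toComplex Y))^[m] ψ)) atTop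
      (𝓝 (C.physCls (weyl Y ψ))) := by
  rw [tendsto_iff_norm_sub_tendsto_zero]
  obtain ⟨K, hK⟩ : ∃ K, K = 2 * ‖sympl Z (toComplex Y)‖ := ⟨_, rfl⟩
  have hK0 : 0 ≤ K := by rw [hK]; positivity
  have hle : ∀ M : ℕ, ‖C.physCls (∑ m ∈ Finset.range (M + 1),
      ((m.factorial : ℂ)⁻¹ * Complex.I ^ m) • (Omega (toComplex Y))^[m] ψ) -
        C.physCls (weyl Y ψ)‖ ≤ √((2 * K) ^ M / M.factorial * (K * ‖C.form ψ ψ‖)) := by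
    intro M
    rw [norm_sub_rev, ← map_sub]
    refine (C.norm_weyl_sub_sum_le hY ψ M).trans (Real.le_sqrt_of_sq_le ?_)
    have h1 := C.norm_iterate_Omega_sq_le hY hZ hYZ hψ (M + 1)
    rw [← hK] at h1
    -- The squared remainder is at most a constant times K^(M+1) (M+1)!/(M!)². Bounding M + 1 by 2^M
    -- leaves (2K)^M/M!, which tends to 0.
    have h2 : ((M + 1 : ℕ) : ℝ) ≤ 2 ^ M := by exact_mod_cast Nat.lt_two_pow_self
    have h3 : (0 : ℝ) < M.factorial := by exact_mod_cast M.factorial_pos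
    rw [div_pow, div_le_iff₀ (by positivity)]
    refine h1.trans ?_
    rw [Nat.factorial_succ, Nat.cast_mul]
    calc _ ≤ K ^ (M + 1) * (2 ^ M * M.factorial) * ‖C.form ψ ψ‖ := by gcongr
      _ = _ := by rw [mul_pow]; field_simp; ring
  refine squeeze_zero (fun M => norm_nonneg _) hle ?_
  have := ((FloorSemiring.tendsto_pow_div_factorial_atTop (2 * K)).mul_const
    (K * ‖C.form ψ ψ‖)).sqrt
  simpa using this

theorem physCls_iterate_Omega_mem {Z : Phase ℂ n} (hZ : Z ∈ C.skewPerpC) (hψ : Omega Z ψ = 0)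
    (p : ℕ) : C.physCls ((Omega (star Z))^[p] ψ) ∈ Submodule.span ℂ
      {v : C.PhysSpace | ∃ (p : ℕ) (W : Fin p → C.conjGerm ψ),
        v = ((List.ofFn fun j => C.creation ψ (W j)).prod (C.cls ψ) : C.Quot)} := by
  have hgerm : Z ∈ C.germ ψ := ⟨hZ, by
    rw [omegaQuot_cls, norm_eq_zero]
    exact congrArg C.cls hψ⟩
  -- Words in a single creation operator suffice for each Weyl vector, so the family of factors is
  -- constant.
  let W : C.conjGerm ψ := ⟨star Z, Z, hgerm, rfl⟩
  refine Submodule.subset_span ⟨p, fun _ => W, ?_⟩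
  rw [List.ofFn_const, List.prod_replicate, Module.End.pow_apply]
  have h : ∀ q : ℕ, (C.creation ψ W)^[q] (C.cls ψ) = C.cls ((Omega (star Z))^[q] ψ) := by
    intro q
    induction q with
    | zero => rfl
    | succ q ih =>
      rw [Function.iterate_succ_apply', ih, Function.iterate_succ_apply']
      rfl
  rw [h]
  rfl

theorem physCls_weyl_mem_closure {Y : Phase ℝ n} (hY : Y ∈ C.skewPerp) {Z : Phase ℂ n}
    (hZ : Z ∈ C.skewPerpC) (hYZ : toComplex Y = Z + star Z) (hψ : Omega Z ψ = 0) :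
    C.physCls (weyl Y ψ) ∈ (Submodule.span ℂ
      {v : C.PhysSpace | ∃ (p : ℕ) (W : Fin p → C.conjGerm ψ),
        v = ((List.ofFn fun j => C.creation ψ (W j)).prod (C.cls ψ) : C.Quot)}).topologicalClosure := by
  refine mem_closure_of_tendsto (C.tendsto_sum_iterate_Omega hY hZ hYZ hψ)
    (Eventually.of_forall fun M => ?_)
  rw [map_sum]
  refine Submodule.sum_mem _ fun m _ => ?_
  rw [map_smul]
  refine Submodule.smul_mem _ _ ?_
  have h1 := iterate_mem_span_iterate_sub (a := (Omega Z : Wave n →ₗ[ℂ] Wave n))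
    (x := (Omega (toComplex Y) : Wave n →ₗ[ℂ] Wave n)) (ψ := ψ) (fun φ => Omega_comm Z Y φ) hψ m
  have h2 : (Omega (toComplex Y) : Wave n →ₗ[ℂ] Wave n) - (Omega Z : Wave n →ₗ[ℂ] Wave n)
      = (Omega (star Z) : Wave n →ₗ[ℂ] Wave n) := by
    rw [hYZ, Omega_add]
    ext1 φ
    exact add_sub_cancel_left (Omega Z φ) (Omega (star Z) φ)
  rw [h2] at h1
  have h3 := Submodule.mem_map_of_mem (f := C.physCls) h1
  rw [Submodule.map_span] at h3
  refine Submodule.span_le.2 ?_ h3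
  rintro _ ⟨_, ⟨p, rfl⟩, rfl⟩
  exact C.physCls_iterate_Omega_mem hZ hψ p

theorem dense_span_creation (h : IsGaussian c A ψ) :
    Dense (Submodule.span ℂ {v : C.PhysSpace | ∃ (p : ℕ) (Z : Fin p → C.conjGerm ψ),
      v = ((List.ofFn fun j => C.creation ψ (Z j)).prod (C.cls ψ) : C.Quot)} :
        Set C.PhysSpace) := by
  refine dense_closure.1 ((C.dense_span_weyl h).mono ?_)
  rw [← Submodule.topologicalClosure_coe]
  refine SetLike.coe_subset_coe.2 (Submodule.span_le.2 ?_)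
  rintro _ ⟨⟨Y, hY⟩, rfl⟩
  rw [weylPhys_cls]
  -- X is the element of the plane for which J(Y - X) is skew-orthogonal to the plane; isotropy
  -- keeps Y - X in the skew complement.
  obtain ⟨X, hX, hXY⟩ := exists_mem_sympl_complexStructure_eq h.2.1 h.2.2.1 C.plane
    { toFun := fun X' => sympl (complexStructure A Y) X'
      map_add' := fun _ _ => sympl_add_right _ _ _
      map_smul' := fun _ _ => sympl_smul_right _ _ _ }
  have hsub : ∀ U V W : Phase ℝ n, sympl (U - V) W = sympl U W - sympl V W := fun U V W => by
    rw [sub_eq_add_neg, sympl_add_left, sympl_comm (-V), sympl_neg_right, neg_neg, sympl_comm W,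
      sub_eq_add_neg]
  have hY1 : Y - X ∈ C.skewPerp := fun X' hX' => by
    rw [hsub, hY X' hX', C.isotropic X hX X' hX', sub_zero]
  have hJ : complexStructure A (Y - X) ∈ C.skewPerp := fun X' hX' => by
    rw [map_sub, hsub, hXY X' hX']
    exact sub_self _
  have hcls : C.cls (weyl Y ψ) = C.cls (weyl (Y - X) ψ) := by
    refine C.cls_eq_of_form fun φ => ?_
    rw [← C.form_weyl_of_mem hX φ (weyl (Y - X) ψ), weyl_weyl, sympl_comm, hY1 X hX]
    simp
  rw [hcls]
  set U := Y - X
  set J := complexStructure A U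
  -- U and J are real, so Z + Z* = U; and Ω(J)ψ = iΩ(U)ψ gives Ω(Z)ψ = (Ω(U) + i·iΩ(U))ψ/2 = 0.
  refine C.physCls_weyl_mem_closure (Z := (1 / 2 : ℂ) • (toComplex U + Complex.I • toComplex J)) hY1
    ?_ ?_ ?_
  · rw [mem_skewPerpC_iff]
    intro X' hX'
    have h1 := (C.mem_skewPerpC_iff _).1 (C.toComplex_mem_skewPerpC hY1) X' hX'
    have h2 := (C.mem_skewPerpC_iff _).1 (C.toComplex_mem_skewPerpC hJ) X' hX'
    have h3 : sympl ((1 / 2 : ℂ) • (toComplex U + Complex.I • toComplex J)) (toComplex X')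
        = (1 / 2 : ℂ) * (sympl (toComplex U) (toComplex X') +
          Complex.I * sympl (toComplex J) (toComplex X')) := by
      simp only [sympl, Finset.mul_sum, ← Finset.sum_add_distrib]
      exact Finset.sum_congr rfl fun j _ => by simp; ring
    rw [h3, h1, h2]
    ring
  · rw [star_smul, star_add, star_smul, star_toComplex, star_toComplex]
    ext j <;> simp <;> ring
  · rw [Omega_smul, Omega_add, Omega_smul, _root_.smul_apply, _root_.add_apply, _root_.smul_apply,
      h.Omega_complexStructure, smul_smul, Complex.I_mul_I]
    simp

end ConstraintPlane

end LinearConstraint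

theorem lemma15 {n k : ℕ} (C : LinearConstraint.ConstraintPlane n k) (c : ℂ)
    (A : Matrix (Fin n) (Fin n) ℂ) (ψA : LinearConstraint.Wave n)
    (hψA : LinearConstraint.IsGaussian c A ψA) :
    Dense (Submodule.span ℂ {v : C.PhysSpace | ∃ Y : C.skewPerp,
      v = C.weylPhys Y (C.cls ψA : C.PhysSpace)} : Set C.PhysSpace) ∧
    Dense (Submodule.span ℂ {v : C.PhysSpace | ∃ (p : ℕ) (Z : Fin p → C.conjGerm ψA),
      v = ((List.ofFn fun j => C.creation ψA (Z j)).prod (C.cls ψA) : C.Quot)} :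
        Set C.PhysSpace) :=
  ⟨C.dense_span_weyl hψA, C.dense_span_creation hψA⟩
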